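/- **Setting.** A *brane diagram* $\mathcal D$ is a finite sequence of 5-branes, ordered from left to right, each a D5 brane or an NS5 brane; the intervals between them (and the two formal outer ones) are the D3 branes $X$, with multiplicities $m_X\in\mathbb N$, which are $0$ for the two outer ones. For a 5-brane $i$ let $i^-,i^+$ be the D3 branes to its left and right. Put $W_X=\mathbb C^{m_X}$, $\mathcal G=\prod_X GL(W_X)$, $\mathbb A=\prod_{U\ \mathrm{D5}}\mathbb C^\times$, $\mathbb T=\mathbb A\times\mathbb C^\times_\hbar$. The space $\mathbb M$ consists of tuples of linear maps $A_U:W_{U^+}\to W_{U^-}$, $B_U\in\mathrm{End}(W_{U^-})$, $B'_U\in\mathrm{End}(W_{U^+})$, $a_U:\mathbb C_U\to W_{U^-}$, $b_U:W_{U^+}\to\mathbb C_U$ for the D5 branes $U$, and $C_V:W_{V^+}\to W_{V^-}$, $D_V:W_{V^-}\to W_{V^+}$ for the NS5 branes $V$. The group $\mathcal G$ acts by base change, the $U$-th factor of $\mathbb A$ acts on $\mathbb C_U$ by its standard character, and $\mathbb C^\times_\hbar$ scales $b,B,B',C$ and fixes $A,a,D$. The moment map equations $\mu=0$ are $B_UA_U-A_UB'_U+a_Ub_U=0$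 for every D5 brane $U$ and, for every D3 brane $X$ between 5-branes $i=X^-$ and $j=X^+$, the vanishing of (the contribution of $i$: $B'_i$ if $i$ is D5, $-D_iC_i$ if NS5) plus (the contribution of $j$: $-B_j$ if $j$ is D5, $C_jD_j$ if NS5). Let $\widetilde{\mathcal M}\subset\mu^{-1}(0)$ be the set of points such that for every D5 brane $U$: (S1) $0$ is the only $B'_U$-invariant subspace of $\ker A_U\cap\ker b_U$; (S2) $W_{U^-}$ is the only $B_U$-invariant subspace containing $\mathrm{im}\,A_U+\mathrm{im}\,a_U$. Let $\chi(g)=\prod_V\det g_{V^+}$, over the NS5 branes $V$. A point $m\in\widetilde{\mathcal M}$ is *stable* if for $z\neq0$ the orbit of $(m,z)$ under $g(m,z)=(gm,\chi(g)^{-1}z)$ is closed in $\widetilde{\mathcal M}\times\mathbb C$ and its stabilizer is finite. The *bow variety* is the quotient $\mathrm{Ch}(\mathcal D)=\{\text{stable points}\}/\mathcal G$; $\mathcal G$ acts freely on the stable points, and $\mathbb T$ acts on $\mathrm{Ch}(\mathcal D)$. The *tautological bundle* $\xi_X$ is the $\mathbb T$-equivariant vector bundle on $\mathrm{Ch}(\mathcal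 D)$ associated with the representation $W_X$ of $\mathcal G$. Let $\mathbf u_U,\mathbf h$ be the coordinate characters of $\mathbb T$ and $u_U,\hbar$ their first Chern classes. A $\mathbb T$-fixed point $f$ has restriction maps $$\mathrm{Loc}^K_f:K_{\mathbb T}(\mathrm{Ch}(\mathcal D))\to K_{\mathbb T}(f)=\mathbb C[\mathbf u_U^{\pm1},\mathbf h^{\pm1}],\qquad \mathrm{Loc}_f:H^*_{\mathbb T}(\mathrm{Ch}(\mathcal D))\to H^*_{\mathbb T}(f)=\mathbb C[u_U,\hbar]$$ (complex coefficients). **Butterfly diagrams.** A *tie diagram* is a set of pairs (NS5 brane, D5 brane) such that every D3 brane $X$ lies between the two members of exactly $m_X$ of the pairs. Its *butterfly diagram* is the disjoint union, over the D5 branes $U$, of the following diagrams of dots. Below each D3 brane $X$ there is a column of consecutive dots, as many as the number of pairs containing $U$ that cover $X$. Adjacent columns are aligned at the bottom if a D5 brane separates them. If an NS5 brane separates them, they are aligned at the top to the right of $U$; to the left of $U$, the top of the left column is one unit below the top of the right column. The *base level* of the butterfly of $U$ is the height of the top dot below $U^-$, or, if there is no dot below $U^-$, one unit below the bottom dot below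 $U^+$. The monomial of a dot of the butterfly of $U$ lying $s\in\mathbb Z$ units above the base level is $\mathbf u_U\mathbf h^s$. The butterfly diagram defines a point of $\mathbb M$, up to $\mathcal G$: the dots below $X$ are a basis of $W_X$; across a D5 brane $A$ maps a dot to the dot at the same height on its left; $-B_U$ and $-B'_U$ map a dot to the dot one unit below it; across an NS5 brane $C$ maps a dot to the dot on its left and one unit lower, and $D$ maps a dot to the dot at the same height on its right (all inside one butterfly, and to $0$ if there is no such dot); $a_U(1)$ is the top dot below $U^-$ in the butterfly of $U$ ($0$ if there is none); $-b_U$ maps the dot below $U^+$ in the butterfly of $U$ one unit above the base level to $1$, and all other dots to $0$. It is the butterfly diagram *of the fixed point $f$* if this point is stable and represents $f$. **Theorem.** Let $f\in\mathrm{Ch}(\mathcal D)$ be a $\mathbb T$-fixed point with a given butterfly diagram, let $X$ be a D3 brane, and let $\mathbf u_{U_1}\mathbf h^{s_1},\dots,\mathbf u_{U_n}\mathbf h^{s_n}$ ($n=m_X$) be the monomials of the dots directly below $X$. Then the restriction to $f$ sends the Grothendieck roots of $\xi_X$ to these monomials, that is, $$\mathrm{Loc}^K_f[\xi_X]=\sum_{r=1}^n\mathbf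 u_{U_r}\mathbf h^{s_r},\qquad \mathrm{Loc}^K_f[\Lambda^k\xi_X]=e_k\big(\mathbf u_{U_1}\mathbf h^{s_1},\dots,\mathbf u_{U_n}\mathbf h^{s_n}\big)\quad(k\ge0),$$ where $e_k$ is the $k$-th elementary symmetric polynomial; and it sends the cohomological Chern roots of $\xi_X$ to $u_{U_r}+s_r\hbar$, that is, $$\mathrm{Loc}_f\,c_k^{\mathbb T}(\xi_X)=e_k\big(u_{U_1}+s_1\hbar,\dots,u_{U_n}+s_n\hbar\big)\quad(k\ge0).$$ -/

import Mathlib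

open scoped ContDiff

noncomputable section

namespace Bow

/-! ### Brane diagrams -/

/-- A (type A) brane diagram: a finite sequence of 5-branes, numbered `0, …, size - 1` from left to
right, each of them a D5 brane or an NS5 brane.  The D3 branes are numbered `0, …, size`; the D3
branes directly to the left and to the right of the 5-brane `i` are `i.castSucc` and `i.succ`.
The formal D3 branes at the two ends have multiplicity `0`. -/
structure BraneDiagram where
  size : ℕ
  isD5 : Fin size → Bool
  mult : Fin (size + 1) → ℕ
  mult_first : mult 0 = 0
  mult_last : mult (Fin.last size) = 0

/-- The D5 branes. -/
abbrev BraneDiagram.D5 (D : BraneDiagram) : Type := {i : Fin D.size // D.isD5 i = true}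

/-- The NS5 branes. -/
abbrev BraneDiagram.NS5 (D : BraneDiagram) : Type := {i : Fin D.size // D.isD5 i = false}

/-- The D3 branes. -/
abbrev BraneDiagram.D3 (D : BraneDiagram) : Type := Fin (D.size + 1)

/-- The vector space `W_X`, with its standard Hermitian inner product. -/
abbrev W (D : BraneDiagram) (X : D.D3) : Type := EuclideanSpace ℂ (Fin (D.mult X))

/-! ### The representation space, the groups and their actions -/

/-- The vector space `𝕄 = ⨁_U 𝕄_U ⊕ ⨁_V 𝕄_V`; the components are
`(A_U, b_U, a_U, B_U, B'_U)` for a D5 brane `U` and `(C_V, D_V)` for an NS5 brane `V`. -/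
def Rep (D : BraneDiagram) : Type :=
  (∀ U : D.D5, (W D U.1.succ →L[ℂ] W D U.1.castSucc) × (W D U.1.succ →L[ℂ] ℂ) ×
      (ℂ →L[ℂ] W D U.1.castSucc) × (W D U.1.castSucc →L[ℂ] W D U.1.castSucc) ×
      (W D U.1.succ →L[ℂ] W D U.1.succ)) ×
  (∀ V : D.NS5, (W D V.1.succ →L[ℂ] W D V.1.castSucc) × (W D V.1.castSucc →L[ℂ] W D V.1.succ))

instance (D : BraneDiagram) : NormedAddCommGroup (Rep D) :=
  inferInstanceAs (NormedAddCommGroup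
    ((∀ U : D.D5, (W D U.1.succ →L[ℂ] W D U.1.castSucc) × (W D U.1.succ →L[ℂ] ℂ) ×
      (ℂ →L[ℂ] W D U.1.castSucc) × (W D U.1.castSucc →L[ℂ] W D U.1.castSucc) ×
      (W D U.1.succ →L[ℂ] W D U.1.succ)) ×
    (∀ V : D.NS5, (W D V.1.succ →L[ℂ] W D V.1.castSucc) ×
      (W D V.1.castSucc →L[ℂ] W D V.1.succ))))

instance (D : BraneDiagram) : NormedSpace ℂ (Rep D) :=
  inferInstanceAs (NormedSpace ℂ
    ((∀ U : D.D5, (W D U.1.succ →L[ℂ] W D U.1.castSucc) × (W D U.1.succ →L[ℂ] ℂ) ×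
      (ℂ →L[ℂ] W D U.1.castSucc) × (W D U.1.castSucc →L[ℂ] W D U.1.castSucc) ×
      (W D U.1.succ →L[ℂ] W D U.1.succ)) ×
    (∀ V : D.NS5, (W D V.1.succ →L[ℂ] W D V.1.castSucc) ×
      (W D V.1.castSucc →L[ℂ] W D V.1.succ))))

namespace Rep

variable {D : BraneDiagram}

/-- `A_U : W_{U⁺} → W_{U⁻}`. -/
def A (m : Rep D) (U : D.D5) : W D U.1.succ →L[ℂ] W D U.1.castSucc := (m.1 U).1
/-- `b_U : W_{U⁺} → ℂ_U`. -/
def b (m : Rep D) (U : D.D5) : W D U.1.succ →L[ℂ] ℂ := (m.1 U).2.1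
/-- `a_U : ℂ_U → W_{U⁻}`. -/
def a (m : Rep D) (U : D.D5) : ℂ →L[ℂ] W D U.1.castSucc := (m.1 U).2.2.1
/-- `B_U`, an endomorphism of `W_{U⁻}`. -/
def B (m : Rep D) (U : D.D5) : W D U.1.castSucc →L[ℂ] W D U.1.castSucc := (m.1 U).2.2.2.1
/-- `B'_U`, an endomorphism of `W_{U⁺}`. -/
def B' (m : Rep D) (U : D.D5) : W D U.1.succ →L[ℂ] W D U.1.succ := (m.1 U).2.2.2.2
/-- `C_V : W_{V⁺} → W_{V⁻}`. -/
def C (m : Rep D) (V : D.NS5) : W D V.1.succ →L[ℂ] W D V.1.castSucc := (m.2 V).1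
/-- `D_V : W_{V⁻} → W_{V⁺}`. -/
def Dmap (m : Rep D) (V : D.NS5) : W D V.1.castSucc →L[ℂ] W D V.1.succ := (m.2 V).2

end Rep

/-- The gauge group `𝒢 = ∏_X GL(W_X)`. -/
abbrev Gauge (D : BraneDiagram) : Type := ∀ X : D.D3, (W D X →L[ℂ] W D X)ˣ

/-- The torus `𝕋 = 𝔸 × ℂ^×_ħ`, where `𝔸 = (ℂ^×)^{D5 branes}`. -/
abbrev Torus (D : BraneDiagram) : Type := (D.D5 → ℂˣ) × ℂˣ

/-- The group `𝒢 × 𝕋`. -/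
abbrev Grp (D : BraneDiagram) : Type := Gauge D × Torus D

/-- The operator `g_X` on `W_X`. -/
def gl {D : BraneDiagram} (γ : Grp D) (X : D.D3) : W D X →L[ℂ] W D X := (γ.1 X).val

/-- The operator `g_X⁻¹` on `W_X`. -/
def gi {D : BraneDiagram} (γ : Grp D) (X : D.D3) : W D X →L[ℂ] W D X := (γ.1 X).inv

/-- The coordinate `𝐮_U : 𝕋 → ℂ^×`. -/
def tu {D : BraneDiagram} (t : Torus D) (U : D.D5) : ℂ := (t.1 U : ℂ)

/-- The coordinate `𝐡 : 𝕋 → ℂ^×`. -/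
def th {D : BraneDiagram} (t : Torus D) : ℂ := (t.2 : ℂ)

/-- The action of `𝒢 × 𝕋` on `𝕄`: `𝒢` acts by change of bases of the `W_X`, the `U`-th factor of `𝔸`
acts by scaling `ℂ_U`, and `ℂ^×_ħ` scales `b, B, B', C` and fixes `A, a, D`. -/
def Rep.act {D : BraneDiagram} (γ : Grp D) (m : Rep D) : Rep D :=
  (fun U =>
    (gl γ U.1.castSucc ∘L m.A U ∘L gi γ U.1.succ,
     (th γ.2 * tu γ.2 U) • (m.b U ∘L gi γ U.1.succ),
     (tu γ.2 U)⁻¹ • (gl γ U.1.castSucc ∘L m.a U),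
     th γ.2 • (gl γ U.1.castSucc ∘L m.B U ∘L gi γ U.1.castSucc),
     th γ.2 • (gl γ U.1.succ ∘L m.B' U ∘L gi γ U.1.succ)),
   fun V =>
    (th γ.2 • (gl γ V.1.castSucc ∘L m.C V ∘L gi γ V.1.succ),
     gl γ V.1.succ ∘L m.Dmap V ∘L gi γ V.1.castSucc))

section ActLemmas

variable {D : BraneDiagram}

@[simp] theorem gl_one (X : D.D3) : gl (1 : Grp D) X = ContinuousLinearMap.id ℂ _ := rfl
@[simp] theorem gi_one (X : D.D3) : gi (1 : Grp D) X = ContinuousLinearMap.id ℂ _ := rfl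
theorem gl_mul (γ δ : Grp D) (X : D.D3) : gl (γ * δ) X = gl γ X ∘L gl δ X := rfl
theorem gi_mul (γ δ : Grp D) (X : D.D3) : gi (γ * δ) X = gi δ X ∘L gi γ X := rfl
@[simp] theorem gl_gi (γ : Grp D) (X : D.D3) (w : W D X) : gl γ X (gi γ X w) = w :=
  DFunLike.congr_fun (γ.1 X).val_inv w
@[simp] theorem gi_gl (γ : Grp D) (X : D.D3) (w : W D X) : gi γ X (gl γ X w) = w :=
  DFunLike.congr_fun (γ.1 X).inv_val w
@[simp] theorem tu_one (U : D.D5) : tu (1 : Torus D) U = 1 := rfl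
@[simp] theorem th_one : th (1 : Torus D) = 1 := rfl
theorem tu_mul (s t : Torus D) (U : D.D5) : tu (s * t) U = tu s U * tu t U := rfl
theorem th_mul (s t : Torus D) : th (s * t) = th s * th t := rfl
theorem tu_ne_zero (t : Torus D) (U : D.D5) : tu t U ≠ 0 := (t.1 U).ne_zero
theorem th_ne_zero (t : Torus D) : th t ≠ 0 := t.2.ne_zero

theorem Rep.ext {m m' : Rep D} (hA : ∀ U, m.A U = m'.A U)
    (hb : ∀ U, m.b U = m'.b U) (ha : ∀ U, m.a U = m'.a U) (hB : ∀ U, m.B U = m'.B U)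
    (hB' : ∀ U, m.B' U = m'.B' U) (hC : ∀ V, m.C V = m'.C V)
    (hD : ∀ V, m.Dmap V = m'.Dmap V) : m = m' :=
  Prod.ext (funext fun U => Prod.ext (hA U) (Prod.ext (hb U) (Prod.ext (ha U)
    (Prod.ext (hB U) (hB' U))))) (funext fun V => Prod.ext (hC V) (hD V))

theorem Rep.act_A (γ : Grp D) (m : Rep D) (U : D.D5) :
    (Rep.act γ m).A U = gl γ U.1.castSucc ∘L m.A U ∘L gi γ U.1.succ := rfl
theorem Rep.act_b (γ : Grp D) (m : Rep D) (U : D.D5) :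
    (Rep.act γ m).b U = (th γ.2 * tu γ.2 U) • (m.b U ∘L gi γ U.1.succ) := rfl
theorem Rep.act_a (γ : Grp D) (m : Rep D) (U : D.D5) :
    (Rep.act γ m).a U = (tu γ.2 U)⁻¹ • (gl γ U.1.castSucc ∘L m.a U) := rfl
theorem Rep.act_B (γ : Grp D) (m : Rep D) (U : D.D5) :
    (Rep.act γ m).B U = th γ.2 • (gl γ U.1.castSucc ∘L m.B U ∘L gi γ U.1.castSucc) := rfl
theorem Rep.act_B' (γ : Grp D) (m : Rep D) (U : D.D5) :
    (Rep.act γ m).B' U = th γ.2 • (gl γ U.1.succ ∘L m.B' U ∘L gi γ U.1.succ) := rfl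
theorem Rep.act_C (γ : Grp D) (m : Rep D) (V : D.NS5) :
    (Rep.act γ m).C V = th γ.2 • (gl γ V.1.castSucc ∘L m.C V ∘L gi γ V.1.succ) := rfl
theorem Rep.act_Dmap (γ : Grp D) (m : Rep D) (V : D.NS5) :
    (Rep.act γ m).Dmap V = gl γ V.1.succ ∘L m.Dmap V ∘L gi γ V.1.castSucc := rfl

theorem Rep.one_act (m : Rep D) : Rep.act 1 m = m := by
  apply Rep.ext <;> intro i
  · simp [Rep.act_A]
  · simp [Rep.act_b]
  · simp [Rep.act_a]
  · simp [Rep.act_B]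
  · simp [Rep.act_B']
  · simp [Rep.act_C]
  · simp [Rep.act_Dmap]

theorem Rep.mul_act (γ δ : Grp D) (m : Rep D) :
    Rep.act (γ * δ) m = Rep.act γ (Rep.act δ m) := by
  apply Rep.ext <;> intro i <;> refine ContinuousLinearMap.ext fun w => ?_
  · simp [Rep.act_A, gl_mul, gi_mul]
  · simp [Rep.act_b, gi_mul, tu_mul, th_mul]; ring
  · simp [Rep.act_a, gl_mul, tu_mul, smul_smul, mul_comm]
  · simp [Rep.act_B, gl_mul, gi_mul, th_mul, smul_smul]
  · simp [Rep.act_B', gl_mul, gi_mul, th_mul, smul_smul]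
  · simp [Rep.act_C, gl_mul, gi_mul, th_mul, smul_smul]
  · simp [Rep.act_Dmap, gl_mul, gi_mul]

end ActLemmas

instance (D : BraneDiagram) : MulAction (Grp D) (Rep D) where
  smul := Rep.act
  one_smul := Rep.one_act
  mul_smul := Rep.mul_act

theorem Rep.smul_def {D : BraneDiagram} (γ : Grp D) (m : Rep D) : γ • m = Rep.act γ m := rfl

/-! ### The moment map, stability and the bow variety -/

/-- The contribution of the 5-brane `i = X⁻` to the `ℕ_X`-component of the moment map, `X = i⁺`:
it is `B'` if `i` is a D5 brane and `-D C` if `i` is an NS5 brane. -/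
def Rep.muLeft {D : BraneDiagram} (m : Rep D) (i : Fin D.size) : W D i.succ →L[ℂ] W D i.succ :=
  if h : D.isD5 i = true then m.B' ⟨i, h⟩
  else -(m.Dmap ⟨i, by simpa using h⟩ ∘L m.C ⟨i, by simpa using h⟩)

/-- The contribution of the 5-brane `i = X⁺` to the `ℕ_X`-component of the moment map, `X = i⁻`:
it is `-B` if `i` is a D5 brane and `C D` if `i` is an NS5 brane. -/
def Rep.muRight {D : BraneDiagram} (m : Rep D) (i : Fin D.size) :
    W D i.castSucc →L[ℂ] W D i.castSucc :=
  if h : D.isD5 i = true then -m.B ⟨i, h⟩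
  else m.C ⟨i, by simpa using h⟩ ∘L m.Dmap ⟨i, by simpa using h⟩

/-- The equation `μ(m) = 0`.  The `ℕ_U`-component is `B_U A_U - A_U B'_U + a_U b_U`.  The
`ℕ_X`-component for the D3 brane `X` between the 5-branes `i` and `i + 1` is
`B' - B`, `C D - D C`, `-D C - B` or `C D + B'`, according to the kinds of the two 5-branes.  (At
the two outermost D3 branes `W_X = 0`.) -/
structure Rep.MomentZero {D : BraneDiagram} (m : Rep D) : Prop where
  d5 : ∀ U : D.D5, m.B U ∘L m.A U - m.A U ∘L m.B' U + m.a U ∘L m.b U = 0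
  d3 : ∀ (i : ℕ) (hi : i + 1 < D.size),
    (show W D ⟨i + 1, Nat.lt_succ_of_lt hi⟩ →L[ℂ] W D ⟨i + 1, Nat.lt_succ_of_lt hi⟩ from
        m.muLeft ⟨i, Nat.lt_of_succ_lt hi⟩) +
      (show W D ⟨i + 1, Nat.lt_succ_of_lt hi⟩ →L[ℂ] W D ⟨i + 1, Nat.lt_succ_of_lt hi⟩ from
        m.muRight ⟨i + 1, hi⟩) = 0

/-- The points of `μ⁻¹(0)` satisfying the conditions (S1) and (S2). -/
structure Rep.IsTilde {D : BraneDiagram} (m : Rep D) : Prop where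
  moment : m.MomentZero
  s1 : ∀ (U : D.D5) (S : Submodule ℂ (W D U.1.succ)), (∀ w ∈ S, m.B' U w ∈ S) →
    (∀ w ∈ S, m.A U w = 0) → (∀ w ∈ S, m.b U w = 0) → S = ⊥
  s2 : ∀ (U : D.D5) (T : Submodule ℂ (W D U.1.castSucc)), (∀ w ∈ T, m.B U w ∈ T) →
    (∀ w, m.A U w ∈ T) → (∀ z, m.a U z ∈ T) → T = ⊤

/-- The character `χ(g) = ∏ det g_{X'}`, over the D3 branes `X'` whose left neighbour is an NS5
brane. -/
def chi {D : BraneDiagram} (g : Gauge D) : ℂ :=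
  ∏ V : D.NS5, LinearMap.det ((g V.1.succ).val : W D V.1.succ →ₗ[ℂ] W D V.1.succ)

/-- The inclusion of `𝒢` in `𝒢 × 𝕋`. -/
def ofGauge {D : BraneDiagram} (g : Gauge D) : Grp D := (g, 1)

/-- The inclusion of `𝕋` in `𝒢 × 𝕋`. -/
def ofTorus {D : BraneDiagram} (t : Torus D) : Grp D := (1, t)

/-- The orbit of `(m, z)` under the action `g (m, z) = (g m, χ(g)⁻¹ z)` of `𝒢`. -/
def gaugeOrbit {D : BraneDiagram} (m : Rep D) (z : ℂ) : Set (Rep D × ℂ) :=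
  Set.range fun g : Gauge D => (ofGauge g • m, (chi g)⁻¹ * z)

/-- `m` is a stable point: it lies in `μ⁻¹(0)`, satisfies (S1) and (S2), and for `z ≠ 0` the orbit of
`(m, z)` is closed in `{points of μ⁻¹(0) with (S1), (S2)} × ℂ` and its stabilizer is finite. -/
structure Rep.IsStable {D : BraneDiagram} (m : Rep D) : Prop where
  tilde : m.IsTilde
  closed : ∀ z : ℂ, z ≠ 0 → ∀ q ∈ closure (gaugeOrbit m z), q.1.IsTilde → q ∈ gaugeOrbit m z
  finite : ∀ z : ℂ, z ≠ 0 → {g : Gauge D | ofGauge g • m = m ∧ (chi g)⁻¹ * z = z}.Finite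

section Invariance

variable {D : BraneDiagram}

theorem Rep.smul_muLeft (γ : Grp D) (m : Rep D) (i : Fin D.size) :
    (γ • m).muLeft i = th γ.2 • (gl γ i.succ ∘L m.muLeft i ∘L gi γ i.succ) := by
  unfold Rep.muLeft
  split_ifs with h
  · rfl
  · refine ContinuousLinearMap.ext fun w => ?_
    simp [Rep.smul_def, Rep.act_C, Rep.act_Dmap]

theorem Rep.smul_muRight (γ : Grp D) (m : Rep D) (i : Fin D.size) :
    (γ • m).muRight i = th γ.2 • (gl γ i.castSucc ∘L m.muRight i ∘L gi γ i.castSucc) := by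
  unfold Rep.muRight
  split_ifs with h
  · refine ContinuousLinearMap.ext fun w => ?_
    simp [Rep.smul_def, Rep.act_B]
  · refine ContinuousLinearMap.ext fun w => ?_
    simp [Rep.smul_def, Rep.act_C, Rep.act_Dmap]

theorem Rep.MomentZero.smul {m : Rep D} (hm : m.MomentZero) (γ : Grp D) :
    (γ • m).MomentZero where
  d5 U := by
    have h := hm.d5 U
    refine ContinuousLinearMap.ext fun w => ?_
    have h' := congrArg (fun v => (th γ.2) • gl γ U.1.castSucc v)
      (DFunLike.congr_fun h (gi γ U.1.succ w))
    simp [smul_sub, smul_add] at h'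
    have := tu_ne_zero γ.2 U
    simp [Rep.smul_def, Rep.act_A, Rep.act_B, Rep.act_B', Rep.act_a, Rep.act_b]
    rw [← h']
    congr 1
    rw [smul_smul]
    congr 1
    field_simp
  d3 i hi := by
    have h := hm.d3 i hi
    rw [Rep.smul_muLeft, Rep.smul_muRight]
    refine ContinuousLinearMap.ext fun w => ?_
    have h' := congrArg (fun v => (th γ.2) • gl γ ⟨i + 1, Nat.lt_succ_of_lt hi⟩ v)
      (DFunLike.congr_fun h (gi γ ⟨i + 1, Nat.lt_succ_of_lt hi⟩ w))
    simp only [add_apply, map_add, smul_add, zero_apply,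
      map_zero, smul_zero] at h'
    exact h'

theorem Rep.IsTilde.smul {m : Rep D} (hm : m.IsTilde) (γ : Grp D) : (γ • m).IsTilde where
  moment := hm.moment.smul γ
  s1 U S hB hA hb := by
    have key := hm.s1 U (S.comap (gl γ U.1.succ : W D U.1.succ →ₗ[ℂ] W D U.1.succ))
      (fun w hw => by
        have := hB _ hw
        simp [Rep.smul_def, Rep.act_B'] at this
        exact (S.smul_mem_iff (th_ne_zero γ.2)).1 this)
      (fun w hw => by
        have := hA _ hw
        simp [Rep.smul_def, Rep.act_A] at this
        simpa using congrArg (gi γ U.1.castSucc) this)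
      (fun w hw => by
        have := hb _ hw
        simpa [Rep.smul_def, Rep.act_b, tu_ne_zero, th_ne_zero] using this)
    rw [Submodule.eq_bot_iff] at key ⊢
    intro w hw
    have := key (gi γ U.1.succ w) (by simpa using hw)
    simpa using congrArg (gl γ U.1.succ) this
  s2 U T hB hA ha := by
    have key := hm.s2 U (T.comap (gl γ U.1.castSucc : W D U.1.castSucc →ₗ[ℂ] W D U.1.castSucc))
      (fun w hw => by
        have := hB _ hw
        simp [Rep.smul_def, Rep.act_B] at this
        exact (T.smul_mem_iff (th_ne_zero γ.2)).1 this)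
      (fun w => by
        have := hA (gl γ U.1.succ w)
        simpa [Rep.smul_def, Rep.act_A] using this)
      (fun z => by
        have := ha z
        simp [Rep.smul_def, Rep.act_a] at this
        exact (T.smul_mem_iff (inv_ne_zero (tu_ne_zero γ.2 U))).1 this)
    rw [Submodule.eq_top_iff'] at key ⊢
    intro w
    simpa using key (gi γ U.1.castSucc w)

theorem Rep.continuous_smul (γ : Grp D) : Continuous fun m : Rep D => γ • m := by
  refine Continuous.prodMk (continuous_pi fun U => ?_) (continuous_pi fun V => ?_)
  · have h : Continuous fun m : Rep D => m.1 U := (continuous_apply U).comp continuous_fst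
    have hA : Continuous fun m : Rep D => m.A U := h.fst
    have hb : Continuous fun m : Rep D => m.b U := h.snd.fst
    have ha : Continuous fun m : Rep D => m.a U := h.snd.snd.fst
    have hB : Continuous fun m : Rep D => m.B U := h.snd.snd.snd.fst
    have hB' : Continuous fun m : Rep D => m.B' U := h.snd.snd.snd.snd
    fun_prop
  · have h : Continuous fun m : Rep D => m.2 V := (continuous_apply V).comp continuous_snd
    have hC : Continuous fun m : Rep D => m.C V := h.fst
    have hD : Continuous fun m : Rep D => m.Dmap V := h.snd
    fun_prop

theorem chi_conj (g h : Gauge D) : chi (h⁻¹ * g * h) = chi g := by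
  refine Finset.prod_congr rfl fun V _ => ?_
  have : (((h⁻¹ * g * h) V.1.succ).val : W D V.1.succ →ₗ[ℂ] W D V.1.succ) =
      ((h V.1.succ).inv : W D V.1.succ →ₗ[ℂ] W D V.1.succ) *
        ((g V.1.succ).val : W D V.1.succ →ₗ[ℂ] W D V.1.succ) *
        ((h V.1.succ).val : W D V.1.succ →ₗ[ℂ] W D V.1.succ) := rfl
  have h1 : ((h V.1.succ).inv : W D V.1.succ →ₗ[ℂ] W D V.1.succ) *
      ((h V.1.succ).val : W D V.1.succ →ₗ[ℂ] W D V.1.succ) = 1 := by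
    refine LinearMap.ext fun w => ?_
    exact DFunLike.congr_fun (h V.1.succ).inv_val w
  rw [this, map_mul, map_mul, mul_right_comm, ← map_mul, h1, map_one, one_mul]

theorem ofGauge_mul_conj (g : Gauge D) (γ : Grp D) :
    ofGauge g * γ = γ * ofGauge (γ.1⁻¹ * g * γ.1) := by
  refine Prod.ext ?_ ?_
  · simp [ofGauge, mul_assoc]
  · simp [ofGauge]

theorem smul_mem_gaugeOrbit (γ : Grp D) {m : Rep D} {z : ℂ} {q : Rep D × ℂ}
    (hq : q ∈ gaugeOrbit m z) : (γ • q.1, q.2) ∈ gaugeOrbit (γ • m) z := by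
  obtain ⟨g, rfl⟩ := hq
  refine ⟨γ.1 * g * γ.1⁻¹, ?_⟩
  have h := ofGauge_mul_conj (γ.1 * g * γ.1⁻¹) γ
  have e : γ.1⁻¹ * (γ.1 * g * γ.1⁻¹) * γ.1 = g := by group
  have c := chi_conj (γ.1 * g * γ.1⁻¹) γ.1
  rw [e] at h c
  simp only [smul_smul, h, c]

theorem Rep.IsStable.smul {m : Rep D} (hm : m.IsStable) (γ : Grp D) : (γ • m).IsStable where
  tilde := hm.tilde.smul γ
  closed z hz q hq hqt := by
    have hmap : Set.MapsTo (fun r : Rep D × ℂ => (γ⁻¹ • r.1, r.2)) (gaugeOrbit (γ • m) z)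
        (gaugeOrbit m z) := fun r hr => by
      simpa using smul_mem_gaugeOrbit γ⁻¹ hr
    have hcont : Continuous fun r : Rep D × ℂ => (γ⁻¹ • r.1, r.2) :=
      ((Rep.continuous_smul γ⁻¹).comp continuous_fst).prodMk continuous_snd
    have h := hm.closed z hz _ (map_mem_closure hcont hq hmap) (hqt.smul γ⁻¹)
    simpa using smul_mem_gaugeOrbit γ h
  finite z hz := by
    refine Set.Finite.of_finite_image (f := fun g : Gauge D => γ.1⁻¹ * g * γ.1)
      ((hm.finite z hz).subset ?_) (fun g _ h _ hgh => by simpa using hgh)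
    rintro _ ⟨g, ⟨h1, h2⟩, rfl⟩
    refine ⟨?_, by rw [chi_conj]; exact h2⟩
    rw [smul_smul, ofGauge_mul_conj, mul_smul] at h1
    simpa using h1

end Invariance

/-- The space of stable points. -/
abbrev Stable (D : BraneDiagram) : Type := {m : Rep D // m.IsStable}

instance (D : BraneDiagram) : MulAction (Grp D) (Stable D) where
  smul γ p := ⟨γ • p.1, p.2.smul γ⟩
  one_smul p := Subtype.ext (one_smul (Grp D) p.1)
  mul_smul γ δ p := Subtype.ext (mul_smul γ δ p.1)

/-- Two stable points are equivalent if they lie in the same `𝒢`-orbit. -/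
def gaugeSetoid (D : BraneDiagram) : Setoid (Stable D) where
  r p q := ∃ g : Gauge D, ofGauge g • p = q
  iseqv :=
    { refl := fun p => ⟨1, one_smul (Grp D) p⟩
      symm := by
        rintro p _ ⟨g, rfl⟩
        exact ⟨g⁻¹, inv_smul_smul (ofGauge g) p⟩
      trans := by
        rintro p _ _ ⟨g, rfl⟩ ⟨h, rfl⟩
        refine ⟨h * g, ?_⟩
        have e : ofGauge (h * g) = ofGauge h * ofGauge g := by simp [ofGauge]
        rw [e, mul_smul] }

/-- The bow variety `Ch(𝒟)`, the quotient of the space of stable points by `𝒢`. -/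
def Ch (D : BraneDiagram) : Type := Quotient (gaugeSetoid D)

/-- The point of `Ch(𝒟)` represented by a stable point. -/
def Ch.mk {D : BraneDiagram} (p : Stable D) : Ch D := Quotient.mk (gaugeSetoid D) p

/-- The action of `𝕋` on `Ch(𝒟)`. -/
instance (D : BraneDiagram) : MulAction (Torus D) (Ch D) where
  smul t := Quotient.map' (s₁ := gaugeSetoid D) (s₂ := gaugeSetoid D) (fun p => ofTorus t • p) (by
    rintro p _ ⟨g, rfl⟩
    refine ⟨g, ?_⟩
    rw [smul_smul, smul_smul]
    congr 1
    simp [ofGauge, ofTorus])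
  one_smul f := by
    induction f using Quotient.inductionOn with
    | h p => exact congrArg Ch.mk (one_smul (Grp D) p)
  mul_smul s t f := by
    induction f using Quotient.inductionOn with
    | h p =>
      refine congrArg Ch.mk ?_
      have : ofTorus (s * t) = ofTorus s * ofTorus t := by simp [ofTorus]
      change ofTorus (s * t) • p = ofTorus s • ofTorus t • p
      rw [this, mul_smul]

/-! ### Polynomial and regular functions -/

/-- The polynomial functions `V → ℂ` on a `𝕜`-vector space: the algebra generated by the
`𝕜`-linear functions. -/
def polyFun (𝕜 V : Type) [CommSemiring 𝕜] [Algebra 𝕜 ℂ] [AddCommMonoid V] [Module 𝕜 V] :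
    Subalgebra ℂ (V → ℂ) :=
  Algebra.adjoin ℂ {f | ∃ l : V →ₗ[𝕜] ℂ, f = l}

/-- A function `f` on a set `S`, embedded in a complex vector space `V` by `j`, is regular if locally
in the Zariski topology it is a quotient of two polynomial functions on `V`. -/
def IsRegular {S V : Type} [AddCommGroup V] [Module ℂ V] (j : S → V) (f : S → ℂ) : Prop :=
  ∀ s, ∃ P ∈ polyFun ℂ V, ∃ Q ∈ polyFun ℂ V, Q (j s) ≠ 0 ∧
    ∀ s', Q (j s') ≠ 0 → f s' = P (j s') / Q (j s')

/-- A set of stable points is open in the Zariski topology. -/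
def IsZariskiOpen {D : BraneDiagram} (S : Set (Stable D)) : Prop :=
  ∀ p ∈ S, ∃ Q ∈ polyFun ℂ (Rep D), Q p.1 ≠ 0 ∧ ∀ q : Stable D, Q q.1 ≠ 0 → q ∈ S

/-- The vector space in which `𝒢 × 𝕋 × 𝕄` is embedded. -/
abbrev Amb (D : BraneDiagram) : Type :=
  (∀ X : D.D3, W D X →L[ℂ] W D X) × (D.D5 → ℂ) × ℂ × Rep D

/-- The embedding of `𝒢 × 𝕋 × {stable points}`. -/
def emb {D : BraneDiagram} (x : Grp D × Stable D) : Amb D :=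
  (gl x.1, tu x.1.2, th x.1.2, x.2.1)

/-! ### Equivariant algebraic vector bundles and K-theory -/

/-- A `𝕋`-equivariant algebraic vector bundle on `Ch(𝒟) = {stable points} / 𝒢`.  As `𝒢` acts freely
on the stable points, this is the same as a `𝒢 × 𝕋`-equivariant algebraic vector bundle on the
variety of stable points: a family of finite-dimensional vector spaces with local frames over Zariski
open sets, and a linear action of `𝒢 × 𝕋` covering the action on the stable points, such that the
matrix coefficients of the action with respect to the frames are regular functions (for the
identity of the group: the transition functions are regular). -/
structure EqBundle (D : BraneDiagram) where
  fiber : Stable D → Type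
  [addCommGroup : ∀ p, AddCommGroup (fiber p)]
  [module : ∀ p, Module ℂ (fiber p)]
  /-- the action of `γ`, from the fibre over `p` to the fibre over `q = γ p` -/
  act : ∀ (γ : Grp D) (p q : Stable D), γ • p = q → (fiber p →ₗ[ℂ] fiber q)
  act_one : ∀ (p : Stable D) (h : (1 : Grp D) • p = p) (v : fiber p), act 1 p p h v = v
  act_mul : ∀ (γ δ : Grp D) (p q r : Stable D) (h : γ • p = q) (h' : δ • q = r)
    (h'' : (δ * γ) • p = r) (v : fiber p), act (δ * γ) p r h'' v = act δ q r h' (act γ p q h v)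
  /-- the local frames -/
  chart : Type
  dom : chart → Set (Stable D)
  dom_open : ∀ c, IsZariskiOpen (dom c)
  dom_cover : ∀ p, ∃ c, p ∈ dom c
  rank : chart → ℕ
  frame : ∀ (c : chart) (p : Stable D), p ∈ dom c → Module.Basis (Fin (rank c)) ℂ (fiber p)
  regular : ∀ (c c' : chart) (i : Fin (rank c)) (i' : Fin (rank c')),
    IsRegular (fun x : {x : Grp D × Stable D // x.2 ∈ dom c ∧ x.1 • x.2 ∈ dom c'} => emb x.1)
      (fun x => (frame c' (x.1.1 • x.1.2) x.2.2).repr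
        (act x.1.1 x.1.2 _ rfl (frame c x.1.2 x.2.1 i)) i')

attribute [instance] EqBundle.addCommGroup EqBundle.module

/-- A morphism of equivariant algebraic vector bundles. -/
structure EqHom {D : BraneDiagram} (E F : EqBundle D) where
  map : ∀ p, E.fiber p →ₗ[ℂ] F.fiber p
  equivariant : ∀ (γ : Grp D) (p q : Stable D) (h : γ • p = q) (v : E.fiber p),
    map q (E.act γ p q h v) = F.act γ p q h (map p v)
  regular : ∀ (c : E.chart) (c' : F.chart) (i : Fin (E.rank c)) (i' : Fin (F.rank c')),
    IsRegular (fun p : {p : Stable D // p ∈ E.dom c ∧ p ∈ F.dom c'} => p.1.1)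
      (fun p => (F.frame c' p.1 p.2.2).repr (map p.1 (E.frame c p.1 p.2.1 i)) i')

/-- There is a short exact sequence `0 → E₁ → E → E₂ → 0`. -/
def IsExtension {D : BraneDiagram} (E₁ E E₂ : EqBundle D) : Prop :=
  ∃ (i : EqHom E₁ E) (q : EqHom E E₂), ∀ p, Function.Injective (i.map p) ∧
    Function.Surjective (q.map p) ∧ LinearMap.range (i.map p) = LinearMap.ker (q.map p)

/-- The relations `[E] = [E₁] + [E₂]` for the short exact sequences `0 → E₁ → E → E₂ → 0`. -/
def kRelations (D : BraneDiagram) : Submodule ℂ (EqBundle D →₀ ℂ) :=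
  Submodule.span ℂ {x | ∃ E₁ E E₂ : EqBundle D, IsExtension E₁ E E₂ ∧
    x = Finsupp.single E 1 - Finsupp.single E₁ 1 - Finsupp.single E₂ 1}

/-- `K_𝕋(Ch(𝒟))`, with complex coefficients: the Grothendieck group of `𝕋`-equivariant algebraic
vector bundles, tensored with `ℂ`. -/
abbrev KT (D : BraneDiagram) : Type 1 := (EqBundle D →₀ ℂ) ⧸ kRelations D

/-- The class `[E]` in `K_𝕋(Ch(𝒟))`. -/
def kClass {D : BraneDiagram} (E : EqBundle D) : KT D :=
  Submodule.Quotient.mk (Finsupp.single E 1)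

/-- The trace is additive on short exact sequences. -/
theorem trace_of_exact {V₁ V V₂ : Type} [AddCommGroup V₁] [Module ℂ V₁] [AddCommGroup V]
    [Module ℂ V] [AddCommGroup V₂] [Module ℂ V₂] [FiniteDimensional ℂ V₁]
    [FiniteDimensional ℂ V] [FiniteDimensional ℂ V₂] (i : V₁ →ₗ[ℂ] V) (q : V →ₗ[ℂ] V₂)
    (hi : Function.Injective i) (hq : Function.Surjective q)
    (hiq : LinearMap.range i = LinearMap.ker q) (φ₁ : V₁ →ₗ[ℂ] V₁) (φ : V →ₗ[ℂ] V)
    (φ₂ : V₂ →ₗ[ℂ] V₂) (h₁ : ∀ v, i (φ₁ v) = φ (i v)) (h₂ : ∀ v, q (φ v) = φ₂ (q v)) :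
    LinearMap.trace ℂ V φ = LinearMap.trace ℂ V₁ φ₁ + LinearMap.trace ℂ V₂ φ₂ := by
  obtain ⟨r, hr⟩ := i.exists_leftInverse_of_injective (LinearMap.ker_eq_bot.2 hi)
  have hr' : ∀ v, r (i v) = v := fun v => LinearMap.congr_fun hr v
  have hqi : ∀ v, q (i v) = 0 := fun v => by
    have : i v ∈ LinearMap.ker q := hiq ▸ LinearMap.mem_range_self i v
    simpa using this
  obtain ⟨s, hs⟩ := q.exists_rightInverse_of_surjective (LinearMap.range_eq_top.2 hq)
  have hs' : ∀ v, q (s v) = v := fun v => LinearMap.congr_fun hs v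
  let σ : V₂ →ₗ[ℂ] V := s - i ∘ₗ r ∘ₗ s
  have hdec : φ = φ ∘ₗ i ∘ₗ r + φ ∘ₗ σ ∘ₗ q := by
    refine LinearMap.ext fun v => ?_
    have hk : v - s (q v) ∈ LinearMap.range i := by
      rw [hiq]; simp [hs']
    obtain ⟨u, hu⟩ := hk
    have hv : v = i u + s (q v) := by rw [hu]; abel
    have : v = i (r v) + σ (q v) := by
      have e : r v = u + r (s (q v)) := by
        conv_lhs => rw [hv]
        rw [map_add, hr']
      simp only [σ, LinearMap.sub_apply, LinearMap.comp_apply, e, map_add]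
      conv_lhs => rw [hv]
      abel
    conv_lhs => rw [this]
    simp
  have t1 : LinearMap.trace ℂ V (φ ∘ₗ i ∘ₗ r) = LinearMap.trace ℂ V₁ φ₁ := by
    have : φ ∘ₗ i ∘ₗ r = (i ∘ₗ φ₁) ∘ₗ r := LinearMap.ext fun v => by simp [h₁]
    rw [this, LinearMap.trace_comp_comm']
    congr 1
    exact LinearMap.ext fun v => by simp [hr']
  have t2 : LinearMap.trace ℂ V (φ ∘ₗ σ ∘ₗ q) = LinearMap.trace ℂ V₂ φ₂ := by
    rw [← LinearMap.comp_assoc, LinearMap.trace_comp_comm']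
    congr 1
    exact LinearMap.ext fun v => by simp [σ, h₂, hs', hqi]
  rw [hdec, map_add, t1, t2]

theorem EqBundle.finiteDimensional {D : BraneDiagram} (E : EqBundle D) (p : Stable D) :
    FiniteDimensional ℂ (E.fiber p) := by
  obtain ⟨c, hc⟩ := E.dom_cover p
  exact Module.Finite.of_basis (E.frame c p hc)

open Classical in
/-- The character of the representation of `𝕋` on the fibre over `f` of a `𝕋`-equivariant vector
bundle on `Ch(𝒟)`, for the point `f` represented by `p`.  The fibre over `f` is the fibre at `p`, and
`t` acts on it by `(g, t)`, where `g ∈ 𝒢` is the element with `(g, t) p = p`; it exists if `f` is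
fixed by `𝕋`, and it is unique as `𝒢` acts freely. -/
def fiberCharacter {D : BraneDiagram} (p : Stable D) (E : EqBundle D) (t : Torus D) : ℂ :=
  if h : ∃ g : Gauge D, (g, t) • p = p then
    LinearMap.trace ℂ (E.fiber p) (E.act (h.choose, t) p p h.choose_spec)
  else 0

/-- The restriction map `Loc_f : K_𝕋(Ch(𝒟)) → K_𝕋(f)` to a fixed point `f`.  Here
`K_𝕋(f) = ℂ[𝐮_U^{±1}, 𝐡^{±1}]` is realized as an algebra of functions on `𝕋`, the class of a
representation of `𝕋` being its character. -/
def locK {D : BraneDiagram} (f : Ch D) : KT D →ₗ[ℂ] (Torus D → ℂ) :=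
  (kRelations D).liftQ
    (Finsupp.lift (Torus D → ℂ) ℂ (EqBundle D) (fiberCharacter (Quotient.out f))) (by
    rw [kRelations, Submodule.span_le]
    rintro _ ⟨E₁, E, E₂, ⟨i, q, hx⟩, rfl⟩
    have key : fiberCharacter (Quotient.out f) E =
        fiberCharacter (Quotient.out f) E₁ + fiberCharacter (Quotient.out f) E₂ := by
      funext t
      rw [Pi.add_apply]
      unfold fiberCharacter
      split_ifs with h
      · have := E₁.finiteDimensional (Quotient.out f)
        have := E.finiteDimensional (Quotient.out f)
        have := E₂.finiteDimensional (Quotient.out f)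
        obtain ⟨h1, h2, h3⟩ := hx (Quotient.out f)
        exact trace_of_exact _ _ h1 h2 h3 _ _ _ (fun v => i.equivariant _ _ _ _ v)
          (fun v => q.equivariant _ _ _ _ v)
      · simp
    change Finsupp.lift (Torus D → ℂ) ℂ (EqBundle D) (fiberCharacter (Quotient.out f)) _ = 0
    rw [map_sub, map_sub]
    simp [key])

/-! ### Tautological bundles -/

theorem polyFun_isRegular {S V : Type} [AddCommGroup V] [Module ℂ V] (j : S → V) {P : V → ℂ}
    (hP : P ∈ polyFun ℂ V) : IsRegular j (fun s => P (j s)) :=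
  fun _ => ⟨P, hP, 1, one_mem _, one_ne_zero, fun _ _ => by simp⟩

/-- The bundle on `Ch(𝒟)` associated with a representation `ρ` of `𝒢 × 𝕋` on `V` whose matrix
coefficients are polynomials in the matrix entries: the trivial bundle `{stable points} × V` with the
diagonal action of `𝒢 × 𝕋`. -/
def assocBundle (D : BraneDiagram) (V : Type) [AddCommGroup V] [Module ℂ V] [FiniteDimensional ℂ V]
    (ρ : Grp D → V →ₗ[ℂ] V) (h1 : ρ 1 = LinearMap.id) (hmul : ∀ γ δ, ρ (γ * δ) = ρ γ ∘ₗ ρ δ)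
    (hreg : ∀ (v : V) (l : V →ₗ[ℂ] ℂ), ∃ P ∈ polyFun ℂ (Amb D),
      ∀ x : Grp D × Stable D, l (ρ x.1 v) = P (emb x)) : EqBundle D where
  fiber _ := V
  act γ _ _ _ := ρ γ
  act_one _ _ v := by rw [h1]; rfl
  act_mul γ δ _ _ _ _ _ _ v := by rw [hmul]; rfl
  chart := Unit
  dom _ := Set.univ
  dom_open _ _ _ := ⟨1, one_mem _, one_ne_zero, fun _ _ => trivial⟩
  dom_cover _ := ⟨(), trivial⟩
  rank _ := Module.finrank ℂ V
  frame _ _ _ := Module.finBasis ℂ V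
  regular _ _ i i' := by
    obtain ⟨P, hP, h⟩ := hreg (Module.finBasis ℂ V i) ((Module.finBasis ℂ V).coord i')
    have := polyFun_isRegular
      (fun x : {x : Grp D × Stable D // x.2 ∈ Set.univ ∧ x.1 • x.2 ∈ Set.univ} => emb x.1) hP
    convert this using 2 with x
    exact h x.1

/-- The tautological bundle `ξ_X`. -/
def taut (D : BraneDiagram) (X : D.D3) : EqBundle D :=
  assocBundle D (W D X) (fun γ => (gl γ X : W D X →ₗ[ℂ] W D X)) rfl (fun _ _ => rfl)
    (fun v l => ⟨fun y => l (y.1 X v), Algebra.subset_adjoin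
      ⟨{ toFun := fun y => l (y.1 X v), map_add' := by simp, map_smul' := by simp }, rfl⟩,
      fun _ => rfl⟩)

/-- Matrix coefficients of exterior powers are polynomials in the coordinates. -/
theorem exteriorPower_coeff_mem {S V : Type} [NormedAddCommGroup V] [InnerProductSpace ℂ V]
    {n : ℕ} (e : Module.Basis (Fin n) ℂ V) (𝒜 : Subalgebra ℂ (S → ℂ)) (y : S → V →ₗ[ℂ] V)
    (hy : ∀ v i, (fun s => e.repr (y s v) i) ∈ 𝒜) (k : ℕ) (l : ⋀[ℂ]^k V →ₗ[ℂ] ℂ) (v : ⋀[ℂ]^k V) :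
    (fun s => l (exteriorPower.map k (y s) v)) ∈ 𝒜 := by
  have hv : v ∈ Submodule.span ℂ (Set.range (exteriorPower.ιMulti ℂ k (M := V))) := by
    rw [exteriorPower.ιMulti_span]; trivial
  induction hv using Submodule.span_induction with
  | mem x hx =>
    obtain ⟨w, rfl⟩ := hx
    have : (fun s => l (exteriorPower.map k (y s) (exteriorPower.ιMulti ℂ k w))) =
        ∑ r : Fin k → Fin n, l (exteriorPower.ιMulti ℂ k (fun i => e (r i))) •
          ∏ i, (fun s => e.repr (y s (w i)) (r i)) := by
      funext s
      rw [exteriorPower.map_apply_ιMulti]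
      have h : (y s ∘ w) = fun i => ∑ j, e.repr (y s (w i)) j • e j := by
        funext i; exact (e.sum_repr _).symm
      rw [h]
      have := (exteriorPower.ιMulti ℂ k (M := V)).toMultilinearMap.map_sum
        (fun i (j : Fin n) => e.repr (y s (w i)) j • e j)
      simp only [AlternatingMap.coe_multilinearMap] at this
      rw [this, map_sum, Finset.sum_apply]
      refine Finset.sum_congr rfl fun r _ => ?_
      have := (exteriorPower.ιMulti ℂ k (M := V)).toMultilinearMap.map_smul_univ
        (fun i => e.repr (y s (w i)) (r i)) (fun i => e (r i))
      simp only [AlternatingMap.coe_multilinearMap] at this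
      rw [this, map_smul]
      simp [mul_comm]
    rw [this]
    exact Subalgebra.sum_mem _ fun r _ => Subalgebra.smul_mem _
      (Subalgebra.prod_mem _ fun i _ => hy _ _) _
  | zero =>
    simp only [map_zero]
    exact Subalgebra.zero_mem 𝒜
  | add x z _ _ hx hz =>
    simp only [map_add]
    exact Subalgebra.add_mem 𝒜 hx hz
  | smul c x _ hx =>
    simp only [map_smul]
    exact Subalgebra.smul_mem 𝒜 hx c

/-- The `i`-th coordinate of `y_X w`, as a linear function. -/
def matCoeff (D : BraneDiagram) (X : D.D3) (w : W D X) (i : Fin (D.mult X)) : Amb D →ₗ[ℂ] ℂ where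
  toFun y := (EuclideanSpace.basisFun (Fin (D.mult X)) ℂ).toBasis.repr (y.1 X w) i
  map_add' := by simp
  map_smul' := by simp

/-- The exterior power `Λ^k ξ_X` of the tautological bundle. -/
def tautExt (D : BraneDiagram) (X : D.D3) (k : ℕ) : EqBundle D :=
  assocBundle D (⋀[ℂ]^k (W D X))
    (fun γ => exteriorPower.map k (gl γ X : W D X →ₗ[ℂ] W D X)) exteriorPower.map_id
    (fun γ δ => exteriorPower.map_comp (gl δ X : W D X →ₗ[ℂ] W D X) (gl γ X : W D X →ₗ[ℂ] W D X))
    (fun v l => ⟨fun y => l (exteriorPower.map k (y.1 X : W D X →ₗ[ℂ] W D X) v),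
      exteriorPower_coeff_mem (EuclideanSpace.basisFun (Fin (D.mult X)) ℂ).toBasis
        (polyFun ℂ (Amb D)) (fun y : Amb D => (y.1 X : W D X →ₗ[ℂ] W D X))
        (fun w i => Algebra.subset_adjoin ⟨matCoeff D X w i, rfl⟩) k l v,
      fun _ => rfl⟩)

/-! ### Equivariant cohomology -/

/-- The Hermitian operators on `W_X`. -/
abbrev Herm (D : BraneDiagram) (X : D.D3) : Type := selfAdjoint.submodule ℝ (W D X →L[ℂ] W D X)

instance (D : BraneDiagram) (X : D.D3) : AddCommGroup (Herm D X) :=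
  Submodule.addCommGroup _

instance (D : BraneDiagram) (X : D.D3) : Module ℝ (Herm D X) := Submodule.module _

/-- The Lie algebra of the maximal compact subgroup `∏ U(W_X) × U(1)^{D5 branes} × U(1)` of `𝒢 × 𝕋`.
An element `ξ = (y, u, ħ)`, with `y_X` Hermitian and `u_U, ħ` real, stands for the tangent vector
`2πi (y, u, ħ)` of this group at the identity. -/
abbrev LieAlg (D : BraneDiagram) : Type :=
  (∀ X : D.D3, Herm D X) × (D.D5 → ℝ) × ℝ

instance (D : BraneDiagram) : AddCommGroup (LieAlg D) := Prod.instAddCommGroup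

instance (D : BraneDiagram) : Module ℝ (LieAlg D) := Prod.instModule

/-- The Lie algebra of the maximal compact subgroup `U(1)^{D5 branes} × U(1)` of `𝕋`, with its
coordinates `u_U` and `ħ`, which are the first Chern classes of the characters `𝐮_U` and `𝐡`. -/
abbrev LieT (D : BraneDiagram) : Type := (D.D5 → ℝ) × ℝ

/-- The operator `y_X` on `W_X`. -/
def LieAlg.y {D : BraneDiagram} (ξ : LieAlg D) (X : D.D3) : W D X →L[ℂ] W D X := (ξ.1 X).1

/-- The vector field on `𝕄` generated by `ξ`: the derivative at `s = 0` of `exp (2πi s ξ) m`. -/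
def infAct {D : BraneDiagram} (ξ : LieAlg D) (m : Rep D) : Rep D :=
  (2 * Real.pi * Complex.I : ℂ) • show Rep D from
    (fun U =>
      (ξ.y U.1.castSucc ∘L m.A U - m.A U ∘L ξ.y U.1.succ,
       ((ξ.2.2 : ℂ) + ξ.2.1 U) • m.b U - m.b U ∘L ξ.y U.1.succ,
       ξ.y U.1.castSucc ∘L m.a U - (ξ.2.1 U : ℂ) • m.a U,
       ξ.y U.1.castSucc ∘L m.B U - m.B U ∘L ξ.y U.1.castSucc + (ξ.2.2 : ℂ) • m.B U,
       ξ.y U.1.succ ∘L m.B' U - m.B' U ∘L ξ.y U.1.succ + (ξ.2.2 : ℂ) • m.B' U),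
     fun V =>
      (ξ.y V.1.castSucc ∘L m.C V - m.C V ∘L ξ.y V.1.succ + (ξ.2.2 : ℂ) • m.C V,
       ξ.y V.1.succ ∘L m.Dmap V - m.Dmap V ∘L ξ.y V.1.castSucc))

/-- The elements of the maximal compact subgroup. -/
def IsUnitary {D : BraneDiagram} (γ : Grp D) : Prop :=
  (∀ (X : D.D3) (w : W D X), ‖gl γ X w‖ = ‖w‖) ∧ (∀ U, ‖tu γ.2 U‖ = 1) ∧ ‖th γ.2‖ = 1

/-- Complex-valued differential `k`-forms on `𝕄`. -/
abbrev Form (D : BraneDiagram) (k : ℕ) : Type := Rep D → (Rep D) [⋀^Fin k]→L[ℝ] ℂ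

/-- `η` is smooth in a neighbourhood of the space of stable points. -/
def Form.IsSmooth {D : BraneDiagram} {k : ℕ} (η : Form D k) : Prop :=
  ∃ O : Set (Rep D), IsOpen O ∧ (∀ m : Rep D, m.IsStable → m ∈ O) ∧ ContDiffOn ℝ ∞ η O

/-- The tangent vectors at `m` of the submanifold of stable points: the velocities of smooth curves
of stable points. -/
def tangent {D : BraneDiagram} (m : Rep D) : Set (Rep D) :=
  {v | ∃ c : ℝ → Rep D, ContDiff ℝ ∞ c ∧ (∀ s, (c s).IsStable) ∧ c 0 = m ∧ deriv c 0 = v}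

/-- Families `(α_k)_k` of functions from the Lie algebra to the `k`-forms on `𝕄`. -/
abbrev PreCochain (D : BraneDiagram) : Type := ∀ k : ℕ, LieAlg D → Form D k

/-- Two differential forms on a neighbourhood of the space of stable points have the same restriction
to this space. -/
def SameOnStable {D : BraneDiagram} {k : ℕ} (η η' : Form D k) : Prop :=
  ∀ m : Rep D, m.IsStable → ∀ v : Fin k → Rep D, (∀ i, v i ∈ tangent m) → η m v = η' m v

/-- Equivariance, on the space of stable points: `α(Ad_γ ξ) = (γ⁻¹)^* α(ξ)` for `γ` in the maximal
compact subgroup. -/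
def PreCochain.IsEquivariant {D : BraneDiagram} (α : PreCochain D) : Prop :=
  ∀ (γ : Grp D), IsUnitary γ → ∀ ξ ξ' : LieAlg D,
    (∀ X, ξ'.y X ∘L gl γ X = gl γ X ∘L ξ.y X) → ξ'.2 = ξ.2 →
    ∀ (k : ℕ) (m : Rep D), m.IsStable → ∀ v : Fin k → Rep D, (∀ i, v i ∈ tangent m) →
      α k ξ' (γ • m) (fun i => γ • v i) = α k ξ m v

/-- The equivariant differential forms on the space of stable points, for the maximal compact subgroup
of `𝒢 × 𝕋` (Cartan model): equivariant polynomial maps from the Lie algebra to differential forms,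
represented by forms on neighbourhoods in `𝕄`. -/
def cochains (D : BraneDiagram) : Submodule ℂ (PreCochain D) where
  carrier := {α | (∀ k, α k ∈ Submodule.span ℂ
    {β : LieAlg D → Form D k | ∃ P ∈ polyFun ℝ (LieAlg D), ∃ η : Form D k, η.IsSmooth ∧
      β = fun ξ m => P ξ • η m}) ∧ α.IsEquivariant}
  zero_mem' := ⟨fun _ => Submodule.zero_mem _, fun _ _ _ _ _ _ _ _ _ _ _ => rfl⟩
  add_mem' := fun hα hβ => ⟨fun k => Submodule.add_mem _ (hα.1 k) (hβ.1 k),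
    fun γ hγ ξ ξ' h h' k m hm v hv =>
      congrArg₂ (· + ·) (hα.2 γ hγ ξ ξ' h h' k m hm v hv) (hβ.2 γ hγ ξ ξ' h h' k m hm v hv)⟩
  smul_mem' := fun c _ hα => ⟨fun k => Submodule.smul_mem _ c (hα.1 k),
    fun γ hγ ξ ξ' h h' k m hm v hv => congrArg (c * ·) (hα.2 γ hγ ξ ξ' h h' k m hm v hv)⟩

/-- The Cartan differential `(d_eq α)(ξ) = d(α(ξ)) - ι_ξ α(ξ)`. -/
def cartanD {D : BraneDiagram} (α : PreCochain D) : PreCochain D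
  | 0, ξ => fun m => -(α 1 ξ m).curryLeft (infAct ξ m)
  | k + 1, ξ => fun m => extDeriv (α k ξ) m - (α (k + 2) ξ m).curryLeft (infAct ξ m)

theorem extDeriv_const_form {D : BraneDiagram} {k : ℕ} (η : (Rep D) [⋀^Fin k]→L[ℝ] ℂ) (m : Rep D) :
    extDeriv (fun _ : Rep D => η) m = 0 := by
  ext v
  rw [extDeriv_apply (differentiableAt_const η)]
  simp

theorem cartanD_zero {D : BraneDiagram} (k : ℕ) (ξ : LieAlg D) (m : Rep D) :
    cartanD (0 : PreCochain D) k ξ m = 0 := by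
  cases k with
  | zero =>
    ext v
    simp [cartanD]
  | succ k =>
    have : extDeriv ((0 : PreCochain D) k ξ) m = 0 := extDeriv_const_form 0 m
    ext v
    simp only [cartanD, this]
    simp

theorem differentiableAt_of_mem_cochains {D : BraneDiagram} {α : PreCochain D}
    (hα : α ∈ cochains D) (k : ℕ) (ξ : LieAlg D) {m : Rep D} (hm : m.IsStable) :
    DifferentiableAt ℝ (α k ξ) m := by
  have h := hα.1 k
  generalize α k = β at h ⊢
  induction h using Submodule.span_induction with
  | mem β hβ =>
    obtain ⟨P, -, η, ⟨O, hO, hsub, hη⟩, rfl⟩ := hβ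
    exact ((hη.contDiffAt (hO.mem_nhds (hsub m hm))).differentiableAt (by simp)).const_smul (P ξ)
  | zero => exact differentiableAt_const _
  | add β β' _ _ h h' => exact h.add h'
  | smul c β _ h => exact h.const_smul c

theorem cartanD_add {D : BraneDiagram} {α β : PreCochain D} (hα : α ∈ cochains D)
    (hβ : β ∈ cochains D) (k : ℕ) (ξ : LieAlg D) {m : Rep D} (hm : m.IsStable) :
    cartanD (α + β) k ξ m = cartanD α k ξ m + cartanD β k ξ m := by
  cases k with
  | zero =>
    ext v
    simp [cartanD]
    ring
  | succ k =>
    have := extDeriv_add (differentiableAt_of_mem_cochains hα k ξ hm)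
      (differentiableAt_of_mem_cochains hβ k ξ hm)
    ext v
    simp [cartanD, this]
    ring

theorem cartanD_smul {D : BraneDiagram} (c : ℂ) {α : PreCochain D} (hα : α ∈ cochains D)
    (k : ℕ) (ξ : LieAlg D) {m : Rep D} (hm : m.IsStable) :
    cartanD (c • α) k ξ m = c • cartanD α k ξ m := by
  cases k with
  | zero =>
    ext v
    simp [cartanD]
  | succ k =>
    have hd := differentiableAt_of_mem_cochains hα k ξ hm
    have : extDeriv (c • α k ξ) m = c • extDeriv (α k ξ) m := by
      ext v
      rw [extDeriv_apply (hd.const_smul c)]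
      simp only [ContinuousAlternatingMap.smul_apply]
      rw [extDeriv_apply hd, Finset.smul_sum]
      refine Finset.sum_congr rfl fun i _ => ?_
      have hd' : DifferentiableAt ℝ (fun x => α k ξ x (i.removeNth v)) m :=
        hd.continuousAlternatingMap_apply_const _
      have := fderiv_const_smul hd' c
      change _ • fderiv ℝ (c • fun x => α k ξ x (i.removeNth v)) m (v i) = _
      rw [this]
      simp [mul_left_comm]
    ext v
    simp [cartanD, this]
    ring

/-- The equivariantly closed forms. -/
def cocycles (D : BraneDiagram) : Submodule ℂ (PreCochain D) where
  carrier := {α | α ∈ cochains D ∧ ∀ k ξ, SameOnStable (cartanD α k ξ) 0}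
  zero_mem' := ⟨Submodule.zero_mem _, fun k ξ m hm v hv => by
    rw [cartanD_zero]; rfl⟩
  add_mem' := fun {α β} hα hβ => ⟨Submodule.add_mem _ hα.1 hβ.1, fun k ξ m hm v hv => by
    rw [cartanD_add hα.1 hβ.1 k ξ hm, ContinuousAlternatingMap.add_apply,
      hα.2 k ξ m hm v hv, hβ.2 k ξ m hm v hv]
    simp⟩
  smul_mem' := fun c α hα => ⟨Submodule.smul_mem _ c hα.1, fun k ξ m hm v hv => by
    rw [cartanD_smul c hα.1 k ξ hm, ContinuousAlternatingMap.smul_apply, hα.2 k ξ m hm v hv]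
    simp⟩

/-- The equivariantly exact forms. -/
def coboundaries (D : BraneDiagram) : Submodule ℂ (PreCochain D) where
  carrier := {α | α ∈ cochains D ∧ ∃ β ∈ cochains D, ∀ k ξ, SameOnStable (α k ξ) (cartanD β k ξ)}
  zero_mem' := ⟨Submodule.zero_mem _, 0, Submodule.zero_mem _, fun k ξ m hm v hv => by
    rw [cartanD_zero]; rfl⟩
  add_mem' := by
    rintro α α' ⟨hα, β, hβ, h⟩ ⟨hα', β', hβ', h'⟩
    refine ⟨Submodule.add_mem _ hα hα', β + β', Submodule.add_mem _ hβ hβ',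
      fun k ξ m hm v hv => ?_⟩
    rw [cartanD_add hβ hβ' k ξ hm, ContinuousAlternatingMap.add_apply, ← h k ξ m hm v hv,
      ← h' k ξ m hm v hv]
    rfl
  smul_mem' := by
    rintro c α ⟨hα, β, hβ, h⟩
    refine ⟨Submodule.smul_mem _ c hα, c • β, Submodule.smul_mem _ c hβ, fun k ξ m hm v hv => ?_⟩
    rw [cartanD_smul c hβ k ξ hm, ContinuousAlternatingMap.smul_apply, ← h k ξ m hm v hv]
    rfl

/-- `H_𝕋^*(Ch(𝒟); ℂ)`: the cohomology of the Cartan complex of the space of stable points for the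
maximal compact subgroup of `𝒢 × 𝕋`.  It is the equivariant cohomology of the quotient `Ch(𝒟)`,
as `𝒢` acts freely on the space of stable points.  (The image of the closed forms in the quotient by the
exact forms.) -/
abbrev HT (D : BraneDiagram) : Type := (cocycles D).map (coboundaries D).mkQ

theorem curryLeft_zero_of_stable {D : BraneDiagram} {m : Rep D} {ξ : LieAlg D}
    (h : infAct ξ m = 0) (α : PreCochain D) : cartanD α 0 ξ m = 0 := by
  ext v
  simp [cartanD, h]

open Classical in
/-- The value of an equivariant form on the infinitesimal stabilizer of `p`: to `τ` in the Lie algebra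
of the maximal compact torus it assigns the degree `0` component of `α(ξ)` at `p`, where `ξ = (y, τ)`
is the element which annihilates `p` (it is unique, if it exists). -/
def evalStabilizer {D : BraneDiagram} (p : Stable D) (α : PreCochain D) (τ : LieT D) : ℂ :=
  if h : ∃ y, infAct ((y, τ) : LieAlg D) p.1 = 0 then α 0 (h.choose, τ) p.1 0 else 0

/-- The point `p` is adapted to the maximal compact subgroup: its stabilizer in this subgroup projects
onto the maximal compact torus of `𝕋` (in terms of Lie algebras). -/
def IsAdapted {D : BraneDiagram} (p : Stable D) : Prop :=
  ∀ τ : LieT D, ∃ y, infAct ((y, τ) : LieAlg D) p.1 = 0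

open Classical in
/-- A point of the `𝒢`-orbit `f` which is adapted to the maximal compact subgroup, if there is one. -/
def adaptedPoint {D : BraneDiagram} (f : Ch D) : Stable D :=
  if h : ∃ p : Stable D, Ch.mk p = f ∧ IsAdapted p then h.choose else Quotient.out f

/-- The restriction map `Loc_f : H_𝕋^*(Ch(𝒟)) → H_𝕋^*(f)` to a fixed point `f`.  Here
`H_𝕋^*(f) = ℂ[u_U, ħ]` is realized as an algebra of functions on the Lie algebra of the maximal
compact torus.  The orbit `f` contains points whose stabilizer in the maximal compact subgroup projects
isomorphically onto the maximal compact torus; the map is the restriction to such a point and to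
its stabilizer. -/
def locH {D : BraneDiagram} (f : Ch D) : HT D →ₗ[ℂ] (LieT D → ℂ) :=
  ((coboundaries D).liftQ
    { toFun := evalStabilizer (adaptedPoint f)
      map_add' := fun α β => by
        funext τ
        simp only [evalStabilizer, Pi.add_apply]
        split_ifs <;> simp
      map_smul' := fun c α => by
        funext τ
        simp only [evalStabilizer, Pi.smul_apply]
        split_ifs <;> simp } (by
    rintro α ⟨-, β, -, h⟩
    refine funext fun τ => ?_
    change evalStabilizer (adaptedPoint f) α τ = 0
    unfold evalStabilizer
    split_ifs with hy
    · have := h 0 (hy.choose, τ) (adaptedPoint f).1 (adaptedPoint f).2 0 (fun i => i.elim0)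
      rw [curryLeft_zero_of_stable hy.choose_spec] at this
      exact this
    · rfl)).domRestrict _

/-! ### Equivariant Chern classes of the tautological bundles -/

/-- The invariant polynomial `y ↦ tr Λ^k(y)`, the coefficient of `s^k` in `det (1 + s y)`. -/
def elemInv {V : Type} [AddCommGroup V] [Module ℂ V] (k : ℕ) (y : V →ₗ[ℂ] V) : ℂ :=
  LinearMap.trace ℂ (⋀[ℂ]^k V) (exteriorPower.map k y)

/-- The Chern form of degree `2k` of `ξ_X`, the bundle associated with the representation `W_X`: the
invariant polynomial `tr Λ^k(y_X)` on the Lie algebra (a `0`-form). -/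
def chernForm (D : BraneDiagram) (X : D.D3) (k : ℕ) : PreCochain D
  | 0, ξ => fun _ => ContinuousAlternatingMap.constOfIsEmpty ℝ (Rep D) (Fin 0)
      (elemInv k (ξ.y X : W D X →ₗ[ℂ] W D X))
  | _ + 1, _ => 0

/-- Conjugate operators have the same invariants. -/
theorem elemInv_conj {V : Type} [AddCommGroup V] [Module ℂ V] [FiniteDimensional ℂ V] (k : ℕ)
    (g h y y' : V →ₗ[ℂ] V) (hgh : g ∘ₗ h = LinearMap.id) (e : y' ∘ₗ g = g ∘ₗ y) :
    elemInv k y' = elemInv k y := by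
  have hhg : h ∘ₗ g = LinearMap.id := mul_eq_one_comm.1 hgh
  have hy' : y' = g ∘ₗ (y ∘ₗ h) := by
    rw [← LinearMap.comp_assoc, ← e, LinearMap.comp_assoc, hgh, LinearMap.comp_id]
  unfold elemInv
  rw [hy', exteriorPower.map_comp, LinearMap.trace_comp_comm', ← exteriorPower.map_comp,
    LinearMap.comp_assoc, hhg, LinearMap.comp_id]

/-- The coordinates of `y_X w`, as linear functions of `ξ`. -/
def lieCoeff (D : BraneDiagram) (X : D.D3) (w : W D X) (i : Fin (D.mult X)) :
    LieAlg D →ₗ[ℝ] ℂ where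
  toFun ξ := (EuclideanSpace.basisFun (Fin (D.mult X)) ℂ).toBasis.repr (ξ.y X w) i
  map_add' ξ ξ' := by simp [LieAlg.y]
  map_smul' c ξ := by simp [LieAlg.y]

theorem elemInv_mem (D : BraneDiagram) (X : D.D3) (k : ℕ) :
    (fun ξ : LieAlg D => elemInv k (ξ.y X : W D X →ₗ[ℂ] W D X)) ∈ polyFun ℝ (LieAlg D) := by
  let bb := Module.finBasis ℂ (⋀[ℂ]^k (W D X))
  have : (fun ξ : LieAlg D => elemInv k (ξ.y X : W D X →ₗ[ℂ] W D X)) =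
      ∑ i, fun ξ : LieAlg D =>
        bb.coord i (exteriorPower.map k (ξ.y X : W D X →ₗ[ℂ] W D X) (bb i)) := by
    funext ξ
    rw [elemInv, LinearMap.trace_eq_matrix_trace ℂ bb, Matrix.trace, Finset.sum_apply]
    refine Finset.sum_congr rfl fun i _ => ?_
    rw [Matrix.diag_apply, LinearMap.toMatrix_apply]
    rfl
  rw [this]
  exact Subalgebra.sum_mem _ fun i _ =>
    exteriorPower_coeff_mem (EuclideanSpace.basisFun (Fin (D.mult X)) ℂ).toBasis
      (polyFun ℝ (LieAlg D)) (fun ξ : LieAlg D => (ξ.y X : W D X →ₗ[ℂ] W D X))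
      (fun w i => Algebra.subset_adjoin ⟨lieCoeff D X w i, rfl⟩) k _ _

theorem chernForm_mem (D : BraneDiagram) (X : D.D3) (k : ℕ) : chernForm D X k ∈ cocycles D := by
  refine ⟨⟨fun j => ?_, ?_⟩, ?_⟩
  · cases j with
    | zero =>
      refine Submodule.subset_span ⟨fun ξ => elemInv k (ξ.y X : W D X →ₗ[ℂ] W D X), ?_,
        fun _ => ContinuousAlternatingMap.constOfIsEmpty ℝ (Rep D) (Fin 0) 1,
        ⟨Set.univ, isOpen_univ, fun _ _ => trivial, contDiffOn_const⟩, ?_⟩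
      · exact elemInv_mem D X k
      · funext ξ m
        ext v
        simp [chernForm]
    | succ j => exact Submodule.zero_mem _
  · intro γ hγ ξ ξ' h h' j m hm v hv
    cases j with
    | zero =>
      change elemInv k (ξ'.y X : W D X →ₗ[ℂ] W D X) = elemInv k (ξ.y X : W D X →ₗ[ℂ] W D X)
      refine elemInv_conj k (gl γ X : W D X →ₗ[ℂ] W D X) (gi γ X : W D X →ₗ[ℂ] W D X) _ _
        (LinearMap.ext fun w => gl_gi γ X w) (LinearMap.ext fun w => ?_)
      exact DFunLike.congr_fun (h X) w
    | succ j => rfl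
  · intro j ξ m hm v hv
    cases j with
    | zero => simp [cartanD, chernForm]
    | succ j =>
      have : extDeriv (chernForm D X k j ξ) m = 0 := by
        cases j with
        | zero => exact extDeriv_const_form _ m
        | succ j => exact extDeriv_const_form 0 m
      simp only [cartanD, this]
      simp [chernForm]

/-- The equivariant Chern class `c_k(ξ_X) ∈ H_𝕋^{2k}(Ch(𝒟))`. -/
def chern (D : BraneDiagram) (X : D.D3) (k : ℕ) : HT D :=
  ⟨(coboundaries D).mkQ (chernForm D X k), Submodule.mem_map_of_mem (chernForm_mem D X k)⟩

/-! ### Tie diagrams and butterfly diagrams -/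

/-- The pair consisting of the NS5 brane `V` and the D5 brane `U` covers the D3 brane `X`: `X` is
between the two 5-branes.  (The 5-brane `i` is to the left of the D3 brane `X` if `i < X`, and
to the right of it if `X ≤ i`.) -/
def Covers {D : BraneDiagram} (X : D.D3) (p : D.NS5 × D.D5) : Prop :=
  (p.1.1.val < X.val ∧ X.val ≤ p.2.1.val) ∨ (p.2.1.val < X.val ∧ X.val ≤ p.1.1.val)

instance {D : BraneDiagram} (X : D.D3) : DecidablePred (Covers X) := fun p =>
  inferInstanceAs (Decidable
    ((p.1.1.val < X.val ∧ X.val ≤ p.2.1.val) ∨ (p.2.1.val < X.val ∧ X.val ≤ p.1.1.val)))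

/-- A tie diagram: a set of pairs (NS5 brane, D5 brane) which covers each D3 brane as many times
as its multiplicity. -/
structure TieDiagram (D : BraneDiagram) where
  ties : Finset (D.NS5 × D.D5)
  cover : ∀ X : D.D3, (ties.filter (Covers X)).card = D.mult X

namespace TieDiagram

variable {D : BraneDiagram} (τ : TieDiagram D)

/-- The number of dots under the D3 brane `X` in the butterfly of the D5 brane `U`: the number of
times that `X` is covered by the ties with one end at `U`. -/
def count (U : D.D5) (X : D.D3) : ℕ := (τ.ties.filter fun p => p.2 = U ∧ Covers X p).card

/-- The height of the top of the column of dots under `X` in the butterfly of `U`, measured from the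
base level of the butterfly.  The top under `U⁻` is at the base level.  Going from `U⁻` to the left,
the top goes down by one at every NS5 brane; it does not change at the D5 branes, where the columns
are aligned from the bottom and have the same number of dots.  At `U` the columns under `U⁻` and
`U⁺` are aligned from the bottom; if there are no dots under `U⁻`, the bottom dot under `U⁺` is one
unit above the base level.  To the right of `U⁺` the top does not change: at an NS5 brane the columns
are aligned from the top, and at a D5 brane they are aligned from the bottom and have the same number
of dots. -/
def top (U : D.D5) (X : D.D3) : ℤ :=
  if X.val ≤ U.1.val then
    -(((Finset.univ : Finset D.NS5).filter fun V => X.val ≤ V.1.val ∧ V.1.val < U.1.val).card : ℤ)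
  else (τ.count U U.1.succ : ℤ) - (τ.count U U.1.castSucc : ℤ)

/-- The heights, above the base level, of the dots under `X` in the butterfly of `U`. -/
def column (U : D.D5) (X : D.D3) : Finset ℤ :=
  Finset.Ioc (τ.top U X - τ.count U X) (τ.top U X)

/-- The dots of the butterfly diagram directly below `X`: the dot `(U, s)` belongs to the butterfly of
`U` and is `s` units above its base level. -/
def dots (X : D.D3) : Finset (Σ _ : D.D5, ℤ) := Finset.univ.sigma fun U => τ.column U X

/-- The basis vector for the dot of height `s` under `X` in the butterfly of `U`, and `0` if there is
no such dot. -/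
def dotVec (e : ∀ X, Module.Basis (τ.dots X) ℂ (W D X)) (X : D.D3) (U : D.D5) (s : ℤ) : W D X :=
  if h : (⟨U, s⟩ : Σ _ : D.D5, ℤ) ∈ τ.dots X then e X ⟨⟨U, s⟩, h⟩ else 0

/-- The point `m` of `𝕄` is given by the butterfly diagram of `τ`: after a choice of bases of the
spaces `W_X` labelled by the dots, `A`, `-B`, `-B'`, `C`, `D` map the basis vectors along the arrows
(and to `0` if there is no arrow), `a_i` maps `1` to the top dot under `i⁻` in the butterfly of `i`, at
height `0`, and `-b_i` maps the dot of height `1` under `i⁺` in the butterfly of `i` to `1`, and the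
other dots to `0`. -/
def Represents (m : Rep D) : Prop :=
  ∃ e : ∀ X, Module.Basis (τ.dots X) ℂ (W D X),
    (∀ (i : D.D5) (d) (h : d ∈ τ.dots i.1.succ),
      m.A i (e _ ⟨d, h⟩) = τ.dotVec e i.1.castSucc d.1 d.2 ∧
      m.B' i (e _ ⟨d, h⟩) = -τ.dotVec e i.1.succ d.1 (d.2 - 1) ∧
      m.b i (e _ ⟨d, h⟩) = if d = ⟨i, 1⟩ then -1 else 0) ∧
    (∀ (i : D.D5) (d) (h : d ∈ τ.dots i.1.castSucc),
      m.B i (e _ ⟨d, h⟩) = -τ.dotVec e i.1.castSucc d.1 (d.2 - 1)) ∧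
    (∀ i : D.D5, m.a i 1 = τ.dotVec e i.1.castSucc i 0) ∧
    (∀ (i : D.NS5) (d) (h : d ∈ τ.dots i.1.succ),
      m.C i (e _ ⟨d, h⟩) = τ.dotVec e i.1.castSucc d.1 (d.2 - 1)) ∧
    (∀ (i : D.NS5) (d) (h : d ∈ τ.dots i.1.castSucc),
      m.Dmap i (e _ ⟨d, h⟩) = τ.dotVec e i.1.succ d.1 d.2)

/-- The butterfly diagram of `τ` is the butterfly diagram of the point `f` of `Ch(𝒟)`: it represents
`f`. -/
def IsButterflyOf (f : Ch D) : Prop := ∃ p : Stable D, Ch.mk p = f ∧ τ.Represents p.1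

end TieDiagram

/-- The monomial `𝐮_U 𝐡^s` in `K_𝕋(pt)`, as a function on `𝕋`. -/
def monoK {D : BraneDiagram} (U : D.D5) (s : ℤ) : Torus D → ℂ := fun t => tu t U * th t ^ s

/-- Its logarithm `u_U + s ħ` in `H_𝕋(pt)`, as a function on the Lie algebra of the maximal compact
torus. -/
def monoH {D : BraneDiagram} (U : D.D5) (s : ℤ) : LieT D → ℂ := fun x => (x.1 U : ℂ) + s * (x.2 : ℂ)

end Bow

end

noncomputable section

namespace Bow

/-! ### Invariants of diagonal operators -/

/-! A butterfly diagram displays its own stabilizer. Let `t` act together with the operators of `𝒢`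
that scale the dot of `U` at height `s` by `𝐮_U 𝐡^s`. The maps `A` and `D` preserve heights and are
not scaled by `𝐡`; `B`, `B'` and `C` lower heights by one and are scaled by `𝐡`, which compensates
exactly. The vector `a_U(1)` is at height `0`, or zero, so its weight is `𝐮_U`; `b_U` reads off the
dot at height `1`, of weight `𝐮_U 𝐡`. Hence the pair fixes the point (`RepresentsIn.smul_eq`), and
differentiating the same count gives the operators with eigenvalues `u_U + s ħ`
(`RepresentsIn.annihilates`).

The restriction maps are defined through a choice of stabilizing element, so uniqueness is also
needed. It follows from stability in `Rep.IsStable.commutes_eq_zero`: operators `N` in the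
infinitesimal stabilizer give a family `1 + cN` fixing the point, and either `χ` is nonconstant
along it, which contradicts the closed orbit, or `χ` is identically `1`, and the finite stabilizer
forces `N = 0`. Applied to `g - 1` this gives freeness (`Rep.IsStable.eq_one`); applied to a
difference of two solutions it gives uniqueness of the infinitesimal compensator (`Annihilates.eq`).

What is left is linear algebra: the trace on `Λ^k` of an operator with an eigenbasis is the `k`-th
elementary symmetric polynomial of the eigenvalues (`elemInv_of_eigenbasis`). In K-theory this is
the character of the fibre; in cohomology it is the value of the Chern form on the stabilizer. The
cohomological restriction uses a point adapted to the compact group;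
`IsButterflyOf.exists_isAdapted` finds one by making the dots an orthonormal basis. -/

/-- The operator which is diagonal with respect to the basis `e`. -/
def diagOp {ι V : Type} [NormedAddCommGroup V] [NormedSpace ℂ V] [FiniteDimensional ℂ V]
    (e : Module.Basis ι ℂ V) (c : ι → ℂ) : V →L[ℂ] V :=
  LinearMap.toContinuousLinearMap (e.constr ℂ fun i => c i • e i)

theorem diagOp_apply {ι V : Type} [NormedAddCommGroup V] [NormedSpace ℂ V]
    [FiniteDimensional ℂ V] (e : Module.Basis ι ℂ V) (c : ι → ℂ) (i : ι) :
    diagOp e c (e i) = c i • e i := by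
  simp [diagOp]

theorem clm_ext_basis {ι V V' : Type} [NormedAddCommGroup V] [NormedSpace ℂ V]
    [NormedAddCommGroup V'] [NormedSpace ℂ V'] (e : Module.Basis ι ℂ V) {f g : V →L[ℂ] V'}
    (h : ∀ i, f (e i) = g (e i)) : f = g :=
  ContinuousLinearMap.coe_injective (e.ext h)

theorem trace_of_eigenbasis {ι V : Type} [Fintype ι] [AddCommGroup V] [Module ℂ V]
    (e : Module.Basis ι ℂ V) (c : ι → ℂ) (y : V →ₗ[ℂ] V) (h : ∀ i, y (e i) = c i • e i) :
    LinearMap.trace ℂ V y = ∑ i, c i := by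
  classical
  rw [LinearMap.trace_eq_matrix_trace ℂ e, Matrix.trace]
  refine Finset.sum_congr rfl fun i _ => ?_
  simp [LinearMap.toMatrix_apply, h]

/-- The wedge products of `k` distinct eigenvectors form an eigenbasis of `Λ^k`, each with the
product of the corresponding `c i` as its eigenvalue. -/
theorem elemInv_of_eigenbasis {ι V : Type} [Fintype ι] [AddCommGroup V] [Module ℂ V]
    (e : Module.Basis ι ℂ V) (c : ι → ℂ) (y : V →ₗ[ℂ] V) (h : ∀ i, y (e i) = c i • e i) (k : ℕ) :
    elemInv k y = ∑ s ∈ Finset.univ.powersetCard k, ∏ i ∈ s, c i := by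
  classical
  -- The basis of the exterior power needs an order on the indices; any one will do, since the final
  -- sum runs over unordered subsets.
  let : LinearOrder ι := linearOrderOfSTO (WellOrderingRel (α := ι))
  rw [elemInv, trace_of_eigenbasis (Module.Basis.exteriorPower k e)
    (fun s => ∏ i ∈ (s : Finset ι), c i)]
  · exact (Finset.sum_subtype _ (fun s => by simp [Set.powersetCard.mem_iff])
      (fun s : Finset ι => ∏ i ∈ s, c i)).symm
  · intro s
    rw [exteriorPower.basis_apply, exteriorPower.ιMulti_family, exteriorPower.map_apply_ιMulti]
    have h' : (y ∘ fun i => e (Set.powersetCard.ofFinEmbEquiv.symm s i)) = fun i =>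
        c (Set.powersetCard.ofFinEmbEquiv.symm s i) •
          e (Set.powersetCard.ofFinEmbEquiv.symm s i) := funext fun i => h _
    have hs := (exteriorPower.ιMulti ℂ k (M := V)).toMultilinearMap.map_smul_univ
      (fun i => c (Set.powersetCard.ofFinEmbEquiv.symm s i))
      (fun i => e (Set.powersetCard.ofFinEmbEquiv.symm s i))
    simp only [AlternatingMap.coe_multilinearMap] at hs
    -- The increasing enumeration of `s` turns the product over `Fin k` into the product over `s`.
    have hp : ∏ i, c (Set.powersetCard.ofFinEmbEquiv.symm s i) = ∏ i ∈ (s : Finset ι), c i := by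
      refine Finset.prod_bij (fun i _ => Set.powersetCard.ofFinEmbEquiv.symm s i) ?_ ?_ ?_ ?_
      · intro i _
        exact (Set.powersetCard.mem_range_ofFinEmbEquiv_symm_iff_mem s _).1 ⟨i, rfl⟩
      · intro i _ j _ hij
        exact (Set.powersetCard.ofFinEmbEquiv.symm s).injective hij
      · intro b hb
        obtain ⟨i, hi⟩ := (Set.powersetCard.mem_range_ofFinEmbEquiv_symm_iff_mem s b).2 hb
        exact ⟨i, Finset.mem_univ _, hi⟩
      · intro _ _; rfl
    rw [Function.comp_def, Function.comp_def] at *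
    rw [h', hs, hp]

/-! ### Infinitesimal automorphisms of stable points -/

section Rigidity

variable {D : BraneDiagram}

/-- The tuple `N` of operators on the spaces `W_X` lies in the infinitesimal stabilizer of `m`
in `𝒢`. -/
structure Commutes (N : ∀ X : D.D3, W D X →L[ℂ] W D X) (m : Rep D) : Prop where
  A : ∀ U, N _ ∘L m.A U = m.A U ∘L N _
  b : ∀ U, m.b U ∘L N _ = 0
  a : ∀ U, N _ ∘L m.a U = 0
  B : ∀ U, N _ ∘L m.B U = m.B U ∘L N _
  B' : ∀ U, N _ ∘L m.B' U = m.B' U ∘L N _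
  C : ∀ V, N _ ∘L m.C V = m.C V ∘L N _
  Dmap : ∀ V, N _ ∘L m.Dmap V = m.Dmap V ∘L N _

/-- A group element fixes `m` if the operators `g_X - 1` commute with the components of `m`. -/
theorem ofGauge_smul_eq {g : Gauge D} {m : Rep D}
    (h : Commutes (fun X => (g X).val - ContinuousLinearMap.id ℂ _) m) : ofGauge g • m = m := by
  have gg : ∀ (X : D.D3) (w : W D X), (g X).val ((g X)⁻¹.val w) = w := fun X w =>
    DFunLike.congr_fun (g X).val_inv w
  have gl_eq : ∀ X, gl (ofGauge g) X = (g X).val := fun _ => rfl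
  have gi_eq : ∀ X, gi (ofGauge g) X = (g X)⁻¹.val := fun _ => rfl
  have t1 : th (ofGauge g).2 = 1 := rfl
  have t2 : ∀ U, tu (ofGauge g).2 U = 1 := fun _ => rfl
  -- Commutation evaluated at `g⁻¹ w` is the invariance of the corresponding component under
  -- conjugation; `a` has no source to be conjugated.
  apply Rep.ext <;> intro i <;> refine ContinuousLinearMap.ext fun w => ?_
  · have := DFunLike.congr_fun (h.A i) ((g _)⁻¹.val w)
    simp [gg] at this
    simp [Rep.smul_def, Rep.act_A, gl_eq, gi_eq, this]
  · have := DFunLike.congr_fun (h.b i) ((g _)⁻¹.val w)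
    simp [gg, sub_eq_zero] at this
    simp [Rep.smul_def, Rep.act_b, gi_eq, t1, t2, this]
  · have := DFunLike.congr_fun (h.a i) w
    simp [sub_eq_zero] at this
    simp [Rep.smul_def, Rep.act_a, gl_eq, t2, this]
  · have := DFunLike.congr_fun (h.B i) ((g _)⁻¹.val w)
    simp [gg] at this
    simp [Rep.smul_def, Rep.act_B, gl_eq, gi_eq, t1, this]
  · have := DFunLike.congr_fun (h.B' i) ((g _)⁻¹.val w)
    simp [gg] at this
    simp [Rep.smul_def, Rep.act_B', gl_eq, gi_eq, t1, this]
  · have := DFunLike.congr_fun (h.C i) ((g _)⁻¹.val w)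
    simp [gg] at this
    simp [Rep.smul_def, Rep.act_C, gl_eq, gi_eq, t1, this]
  · have := DFunLike.congr_fun (h.Dmap i) ((g _)⁻¹.val w)
    simp [gg] at this
    simp [Rep.smul_def, Rep.act_Dmap, gl_eq, gi_eq, this]

theorem Commutes.smul {N : ∀ X : D.D3, W D X →L[ℂ] W D X} {m : Rep D} (h : Commutes N m) (c : ℂ) :
    Commutes (fun X => c • N X) m where
  A U := by rw [ContinuousLinearMap.smul_comp, ContinuousLinearMap.comp_smul, h.A]
  b U := by rw [ContinuousLinearMap.comp_smul, h.b]; ext; simp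
  a U := by rw [ContinuousLinearMap.smul_comp, h.a]; ext; simp
  B U := by rw [ContinuousLinearMap.smul_comp, ContinuousLinearMap.comp_smul, h.B]
  B' U := by rw [ContinuousLinearMap.smul_comp, ContinuousLinearMap.comp_smul, h.B']
  C V := by rw [ContinuousLinearMap.smul_comp, ContinuousLinearMap.comp_smul, h.C]
  Dmap V := by rw [ContinuousLinearMap.smul_comp, ContinuousLinearMap.comp_smul, h.Dmap]

/-- `det (1 + c N)` is a polynomial in `c`. -/
theorem exists_polynomial_det {V : Type} [AddCommGroup V] [Module ℂ V] [FiniteDimensional ℂ V]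
    (N : V →ₗ[ℂ] V) :
    ∃ P : Polynomial ℂ, ∀ c : ℂ, P.eval c = LinearMap.det (LinearMap.id + c • N) := by
  let e := Module.finBasis ℂ V
  -- The determinant is taken over `ℂ[X]`; evaluation at `c` is a ring homomorphism and so commutes
  -- with it.
  refine ⟨Matrix.det (1 + (Polynomial.X : Polynomial ℂ) •
    (LinearMap.toMatrix e e N).map Polynomial.C), fun c => ?_⟩
  rw [← LinearMap.det_toMatrix e, ← Polynomial.coe_evalRingHom, RingHom.map_det]
  congr 1
  ext i j
  by_cases hij : i = j <;> simp [hij, mul_comm c]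

/-- This is the only place where both halves of stability, closed orbit and finite stabilizer, are
used. Along the fixing family `1 + cN` the character `χ` is a polynomial in `c` with value `1` at
`0`, so it is either unbounded or identically `1`; the closed orbit excludes the former, and in the
latter case the finite stabilizer forces `N = 0`. -/
theorem Rep.IsStable.commutes_eq_zero {m : Rep D} (hm : m.IsStable)
    {N : ∀ X : D.D3, W D X →L[ℂ] W D X} (h : Commutes N m) : N = 0 := by
  choose P hP using fun X => exists_polynomial_det (N X : W D X →ₗ[ℂ] W D X)
  -- `Q` detects the parameters for which every `1 + c N_X` is invertible; `R` is the value of `χ`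
  -- on the resulting group element.
  set Q : Polynomial ℂ := ∏ X, P X with hQ
  set R : Polynomial ℂ := ∏ V : D.NS5, P V.1.succ with hR
  have hP0 : ∀ X, (P X).eval 0 = 1 := fun X => by simp [hP]
  have hQ0 : Q ≠ 0 := by
    intro h0
    have : Q.eval 0 = 1 := by rw [hQ, Polynomial.eval_prod]; simp [hP0]
    rw [h0] at this
    simp at this
  have hR0 : R.eval 0 = 1 := by rw [hR, Polynomial.eval_prod]; simp [hP0]
  have hunit : ∀ c, Q.eval c ≠ 0 → ∃ g : Gauge D, ∀ X,
      (g X).val = ContinuousLinearMap.id ℂ _ + c • N X := by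
    intro c hc
    have hX : ∀ X, ∃ u : (W D X →L[ℂ] W D X)ˣ,
        u.val = ContinuousLinearMap.id ℂ _ + c • N X := by
      intro X
      have hd : LinearMap.det (LinearMap.id + c • (N X : W D X →ₗ[ℂ] W D X)) ≠ 0 := by
        rw [← hP]
        rw [hQ, Polynomial.eval_prod] at hc
        exact Finset.prod_ne_zero_iff.1 hc X (Finset.mem_univ X)
      let L := (LinearMap.equivOfDetNeZero _ hd).toContinuousLinearEquiv
      refine ⟨⟨L, L.symm, ?_, ?_⟩, ?_⟩
      · ext1 w; exact L.apply_symm_apply w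
      · ext1 w; exact L.symm_apply_apply w
      · ext1 w; rfl
    choose g hg using hX
    exact ⟨g, hg⟩
  choose! g hg using hunit
  have hfix : ∀ c, Q.eval c ≠ 0 → ofGauge (g c) • m = m := fun c hc => by
    refine ofGauge_smul_eq ?_
    have : (fun X => ((g c) X).val - ContinuousLinearMap.id ℂ _) = fun X => c • N X :=
      funext fun X => by rw [hg c hc]; abel
    rw [this]
    exact h.smul c
  have hchi : ∀ c, Q.eval c ≠ 0 → chi (g c) = R.eval c := fun c hc => by
    rw [hR, Polynomial.eval_prod, chi]
    refine Finset.prod_congr rfl fun V _ => ?_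
    rw [hP, hg c hc]
    rfl
  have hfin : {c | Q.eval c = 0}.Finite := by
    refine (Q.roots.toFinset.finite_toSet).subset fun c hc => ?_
    simpa [hQ0] using hc
  -- If `R` is nonconstant, then `|R(n)| → ∞`, and the points `(m, R(n)⁻¹)` of the orbit of `(m, 1)`
  -- tend to `(m, 0)`.
  rcases lt_or_ge 0 R.degree with hdeg | hdeg
  · exfalso
    have hlim : Filter.Tendsto (fun n : ℕ => (m, (R.eval (n : ℂ))⁻¹ * 1)) Filter.atTop
        (nhds (m, (0 : ℂ))) := by
      refine tendsto_const_nhds.prodMk_nhds ?_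
      rw [tendsto_zero_iff_norm_tendsto_zero]
      have h1 := R.tendsto_norm_atTop hdeg (l := Filter.atTop) (z := fun n : ℕ => (n : ℂ))
        (by simpa using tendsto_natCast_atTop_atTop)
      simpa [Pi.inv_def] using h1.inv_tendsto_atTop
    -- Only finitely many integers are roots of `Q`, so the sequence eventually lies in the orbit.
    have hev : ∀ᶠ n : ℕ in Filter.atTop, Q.eval (n : ℂ) ≠ 0 := by
      rw [← Nat.cofinite_eq_atTop]
      have := hfin.preimage (f := fun n : ℕ => (n : ℂ)) (Nat.cast_injective.injOn)
      exact this.eventually_cofinite_notMem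
    have hcl : (m, (0 : ℂ)) ∈ closure (gaugeOrbit m 1) := by
      refine mem_closure_of_tendsto hlim (hev.mono fun n hn => ⟨g n, ?_⟩)
      simp only [hfix _ hn, hchi _ hn]
    -- The limit has first component `m`, which satisfies the moment map equations, (S1) and (S2),
    -- so it would lie in the orbit; but `χ` takes finite nonzero values, so the second coordinate
    -- never vanishes there.
    obtain ⟨g₀, hg₀⟩ := hm.closed 1 one_ne_zero _ hcl hm.tilde
    have hz : (chi g₀)⁻¹ * 1 = 0 := congrArg Prod.snd hg₀
    have hne : chi g₀ ≠ 0 := by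
      refine Finset.prod_ne_zero_iff.2 fun V _ h0 => ?_
      have hu : ((g₀ V.1.succ).val : W D V.1.succ →ₗ[ℂ] W D V.1.succ) *
          ((g₀ V.1.succ).inv : W D V.1.succ →ₗ[ℂ] W D V.1.succ) = 1 :=
        LinearMap.ext fun w => DFunLike.congr_fun (g₀ V.1.succ).val_inv w
      have := congrArg LinearMap.det hu
      rw [map_mul, h0, map_one, zero_mul] at this
      exact zero_ne_one this
    simp [hne] at hz
  · have hR1 : ∀ c, R.eval c = 1 := fun c => by
      rw [Polynomial.eq_C_of_degree_le_zero hdeg] at hR0 ⊢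
      simpa using hR0
    by_contra hN
    obtain ⟨X, hX⟩ := Function.ne_iff.1 hN
    obtain ⟨w, hw⟩ : ∃ w, N X w ≠ 0 := by
      by_contra! h0
      exact hX (ContinuousLinearMap.ext h0)
    -- With `χ = 1` along the family, every admissible `c` gives an element of the stabilizer of
    -- `(m, 1)`. A vector with `N X w ≠ 0` makes these elements distinct, and there are infinitely
    -- many admissible `c`.
    refine hfin.infinite_compl (Set.Finite.of_finite_image (f := g)
      ((hm.finite 1 one_ne_zero).subset ?_) ?_)
    · rintro _ ⟨c, hc, rfl⟩
      exact ⟨hfix c hc, by rw [hchi c hc, hR1]; simp⟩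
    · intro c hc c' hc' hcc
      have h1 := hg c hc X
      rw [hcc, hg c' hc' X] at h1
      have h2 := DFunLike.congr_fun h1 w
      exact smul_left_injective ℂ hw (add_left_cancel h2).symm

end Rigidity

/-! ### Freeness of the gauge action and uniqueness of infinitesimal stabilizers. -/

section Fixed

variable {D : BraneDiagram}

/-- A stable point has trivial stabilizer in `𝒢`. -/
theorem Rep.IsStable.eq_one {m : Rep D} (hm : m.IsStable) {g : Gauge D}
    (h : ofGauge g • m = m) : g = 1 := by
  have gg : ∀ (X : D.D3) (w : W D X), (g X)⁻¹.val ((g X).val w) = w := fun X w =>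
    DFunLike.congr_fun (g X).inv_val w
  -- That `g` fixes `m` says that `g - 1` commutes with all components; evaluating at `g w` removes
  -- the inverses.
  have key := hm.commutes_eq_zero (N := fun X => (g X).val - ContinuousLinearMap.id ℂ _)
    { A := fun U => by
        have := congrArg (fun q : Rep D => q.A U) h
        ext1 w
        have := DFunLike.congr_fun this ((g _).val w)
        simp [Rep.smul_def, Rep.act_A, gl, gi, ofGauge, gg] at this
        simp [this]
      b := fun U => by
        have := congrArg (fun q : Rep D => q.b U) h
        ext1 w
        have := DFunLike.congr_fun this ((g _).val w)
        simp [Rep.smul_def, Rep.act_b, gi, tu, th, ofGauge, gg] at this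
        simp [← this]
      a := fun U => by
        have := congrArg (fun q : Rep D => q.a U) h
        ext1
        have := DFunLike.congr_fun this 1
        simp [Rep.smul_def, Rep.act_a, gl, tu, ofGauge] at this
        simp [this]
      B := fun U => by
        have := congrArg (fun q : Rep D => q.B U) h
        ext1 w
        have := DFunLike.congr_fun this ((g _).val w)
        simp [Rep.smul_def, Rep.act_B, gl, gi, th, ofGauge, gg] at this
        simp [this]
      B' := fun U => by
        have := congrArg (fun q : Rep D => q.B' U) h
        ext1 w
        have := DFunLike.congr_fun this ((g _).val w)
        simp [Rep.smul_def, Rep.act_B', gl, gi, th, ofGauge, gg] at this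
        simp [this]
      C := fun U => by
        have := congrArg (fun q : Rep D => q.C U) h
        ext1 w
        have := DFunLike.congr_fun this ((g _).val w)
        simp [Rep.smul_def, Rep.act_C, gl, gi, th, ofGauge, gg] at this
        simp [this]
      Dmap := fun U => by
        have := congrArg (fun q : Rep D => q.Dmap U) h
        ext1 w
        have := DFunLike.congr_fun this ((g _).val w)
        simp [Rep.smul_def, Rep.act_Dmap, gl, gi, ofGauge, gg] at this
        simp [this] }
  refine funext fun X => Units.ext ?_
  exact sub_eq_zero.1 (congrFun key X)

/-- The equations for a vector in the kernel of the infinitesimal action. -/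
structure Annihilates (y : ∀ X : D.D3, W D X →L[ℂ] W D X) (x : LieT D) (m : Rep D) : Prop where
  A : ∀ U w, y _ (m.A U w) = m.A U (y _ w)
  b : ∀ U w, m.b U (y _ w) = ((x.2 : ℂ) + x.1 U) * m.b U w
  a : ∀ U, y _ (m.a U 1) = (x.1 U : ℂ) • m.a U 1
  B : ∀ U w, m.B U (y _ w) = y _ (m.B U w) + (x.2 : ℂ) • m.B U w
  B' : ∀ U w, m.B' U (y _ w) = y _ (m.B' U w) + (x.2 : ℂ) • m.B' U w
  C : ∀ V w, m.C V (y _ w) = y _ (m.C V w) + (x.2 : ℂ) • m.C V w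
  Dmap : ∀ V w, y _ (m.Dmap V w) = m.Dmap V (y _ w)

/-- Cancels the factor `2πi` and rearranges each component so that `B`, `B'` and `C` visibly lower
eigenvalues of `y` by `ħ`. -/
theorem infAct_eq_zero_iff (ξ : LieAlg D) (m : Rep D) :
    infAct ξ m = 0 ↔ Annihilates ξ.y ξ.2 m := by
  have hpi : (2 * Real.pi * Complex.I : ℂ) ≠ 0 := Complex.two_pi_I_ne_zero
  unfold infAct
  rw [smul_eq_zero_iff_right hpi]
  constructor
  · intro h
    have h1 := fun U => congrFun (congrArg Prod.fst h) U
    have h2 := fun V => congrFun (congrArg Prod.snd h) V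
    exact
    { A := fun U w => by
        have := DFunLike.congr_fun (congrArg (fun q => q.1) (h1 U)) w
        exact sub_eq_zero.1 this
      b := fun U w => by
        have := DFunLike.congr_fun (congrArg (fun q => q.2.1) (h1 U)) w
        exact (sub_eq_zero.1 this).symm
      a := fun U => by
        have := DFunLike.congr_fun (congrArg (fun q => q.2.2.1) (h1 U)) 1
        exact sub_eq_zero.1 this
      B := fun U w => by
        have := DFunLike.congr_fun (congrArg (fun q => q.2.2.2.1) (h1 U)) w
        exact (sub_eq_zero.1 (Eq.trans (sub_add_eq_add_sub _ _ _).symm this)).symm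
      B' := fun U w => by
        have := DFunLike.congr_fun (congrArg (fun q => q.2.2.2.2) (h1 U)) w
        exact (sub_eq_zero.1 (Eq.trans (sub_add_eq_add_sub _ _ _).symm this)).symm
      C := fun V w => by
        have := DFunLike.congr_fun (congrArg (fun q => q.1) (h2 V)) w
        exact (sub_eq_zero.1 (Eq.trans (sub_add_eq_add_sub _ _ _).symm this)).symm
      Dmap := fun V w => by
        have := DFunLike.congr_fun (congrArg (fun q => q.2) (h2 V)) w
        exact sub_eq_zero.1 this }
  · intro h
    apply Rep.ext <;> intro i
    · exact ContinuousLinearMap.ext fun w => sub_eq_zero.2 (h.A i w)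
    · exact ContinuousLinearMap.ext fun w => sub_eq_zero.2 (h.b i w).symm
    · exact ContinuousLinearMap.ext_ring (sub_eq_zero.2 (h.a i))
    · exact ContinuousLinearMap.ext fun w =>
        (sub_add_eq_add_sub _ _ _).trans (sub_eq_zero.2 (h.B i w).symm)
    · exact ContinuousLinearMap.ext fun w =>
        (sub_add_eq_add_sub _ _ _).trans (sub_eq_zero.2 (h.B' i w).symm)
    · exact ContinuousLinearMap.ext fun w =>
        (sub_add_eq_add_sub _ _ _).trans (sub_eq_zero.2 (h.C i w).symm)
    · exact ContinuousLinearMap.ext fun w => sub_eq_zero.2 (h.Dmap i w)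

/-- The inhomogeneous terms depend only on `x`, so they cancel in `y - y'`, which then commutes with
`m`. No Hermitian condition is imposed: this allows a Hermitian solution to be compared with one
that is diagonal in a basis that need not be orthogonal. -/
theorem Annihilates.eq {m : Rep D} (hm : m.IsStable) {y y' : ∀ X : D.D3, W D X →L[ℂ] W D X}
    {x : LieT D} (h : Annihilates y x m) (h' : Annihilates y' x m) : y = y' := by
  refine sub_eq_zero.1 (hm.commutes_eq_zero (N := y - y') ?_)
  exact
  { A := fun U => by ext1 w; simp [h.A, h'.A]
    b := fun U => by ext1 w; simp [h.b, h'.b]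
    a := fun U => by ext1; simp [h.a, h'.a]
    B := fun U => by ext1 w; simp [h.B, h'.B]
    B' := fun U => by ext1 w; simp [h.B', h'.B']
    C := fun U => by ext1 w; simp [h.C, h'.C]
    Dmap := fun U => by ext1 w; simp [h.Dmap, h'.Dmap] }

end Fixed

/-! ### Points represented by butterfly diagrams -/

namespace TieDiagram

variable {D : BraneDiagram} (τ : TieDiagram D)

/-- The point `m` is given by the butterfly diagram of `τ` in the bases `e`. -/
structure RepresentsIn (e : ∀ X, Module.Basis (τ.dots X) ℂ (W D X)) (m : Rep D) : Prop where
  A : ∀ (i : D.D5) (d : τ.dots i.1.succ),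
    m.A i (e _ d) = τ.dotVec e i.1.castSucc d.1.1 d.1.2
  B' : ∀ (i : D.D5) (d : τ.dots i.1.succ),
    m.B' i (e _ d) = -τ.dotVec e i.1.succ d.1.1 (d.1.2 - 1)
  b : ∀ (i : D.D5) (d : τ.dots i.1.succ), m.b i (e _ d) = if d.1 = ⟨i, 1⟩ then -1 else 0
  B : ∀ (i : D.D5) (d : τ.dots i.1.castSucc),
    m.B i (e _ d) = -τ.dotVec e i.1.castSucc d.1.1 (d.1.2 - 1)
  a : ∀ i : D.D5, m.a i 1 = τ.dotVec e i.1.castSucc i 0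
  C : ∀ (i : D.NS5) (d : τ.dots i.1.succ),
    m.C i (e _ d) = τ.dotVec e i.1.castSucc d.1.1 (d.1.2 - 1)
  Dmap : ∀ (i : D.NS5) (d : τ.dots i.1.castSucc),
    m.Dmap i (e _ d) = τ.dotVec e i.1.succ d.1.1 d.1.2

variable {τ}

theorem Represents.exists_representsIn {m : Rep D} (h : τ.Represents m) :
    ∃ e, τ.RepresentsIn e m := by
  obtain ⟨e, h1, h2, h3, h4, h5⟩ := h
  exact ⟨e, fun i d => (h1 i d.1 d.2).1, fun i d => (h1 i d.1 d.2).2.1,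
    fun i d => (h1 i d.1 d.2).2.2, fun i d => h2 i d.1 d.2, h3, fun i d => h4 i d.1 d.2,
    fun i d => h5 i d.1 d.2⟩

/-- The weight `c` is defined for all pairs, including those without a dot, where both sides vanish.
This removes any case distinction on whether the target of an arrow exists. -/
theorem map_dotVec {e e' : ∀ X, Module.Basis (τ.dots X) ℂ (W D X)} {X : D.D3}
    {g : W D X →L[ℂ] W D X} {c : (Σ _ : D.D5, ℤ) → ℂ} (h : ∀ d, g (e X d) = c d.1 • e' X d)
    (U : D.D5) (s : ℤ) : g (τ.dotVec e X U s) = c ⟨U, s⟩ • τ.dotVec e' X U s := by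
  unfold dotVec
  split_ifs
  · exact h _
  · simp

theorem RepresentsIn.smul {m : Rep D} {e e' : ∀ X, Module.Basis (τ.dots X) ℂ (W D X)}
    (h : τ.RepresentsIn e m) {g : Gauge D} (hl : ∀ X d, gl (ofGauge g) X (e X d) = e' X d) :
    τ.RepresentsIn e' (ofGauge g • m) := by
  have hi : ∀ X d, gi (ofGauge g) X (e' X d) = e X d := fun X d => by rw [← hl, gi_gl]
  have hv : ∀ X U s, gl (ofGauge g) X (τ.dotVec e X U s) = τ.dotVec e' X U s := fun X U s => by
    simpa using map_dotVec (c := fun _ => 1) (fun d => by simpa using hl X d) U s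
  have t1 : th (ofGauge g).2 = 1 := rfl
  have t2 : ∀ U, tu (ofGauge g).2 U = 1 := fun _ => rfl
  exact
    { A := fun i d => by simp [Rep.smul_def, Rep.act_A, hi, h.A, hv]
      B' := fun i d => by simp [Rep.smul_def, Rep.act_B', hi, h.B', hv, t1]
      b := fun i d => by simp [Rep.smul_def, Rep.act_b, hi, h.b, t1, t2]
      B := fun i d => by simp [Rep.smul_def, Rep.act_B, hi, h.B, hv, t1]
      a := fun i => by simp [Rep.smul_def, Rep.act_a, h.a, hv, t2]
      C := fun i d => by simp [Rep.smul_def, Rep.act_C, hi, h.C, hv, t1]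
      Dmap := fun i d => by simp [Rep.smul_def, Rep.act_Dmap, hi, h.Dmap, hv] }

/-- The bases in which a butterfly diagram represents a point can be chosen at will, up to the action
of `𝒢`. -/
theorem RepresentsIn.exists_gauge {m : Rep D} {e : ∀ X, Module.Basis (τ.dots X) ℂ (W D X)}
    (h : τ.RepresentsIn e m) (e' : ∀ X, Module.Basis (τ.dots X) ℂ (W D X)) :
    ∃ g : Gauge D, τ.RepresentsIn e' (ofGauge g • m) := by
  let L := fun X => ((e X).equiv (e' X) (Equiv.refl _)).toContinuousLinearEquiv
  refine ⟨fun X => ⟨L X, (L X).symm,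
    ContinuousLinearMap.ext fun w => (L X).apply_symm_apply w,
    ContinuousLinearMap.ext fun w => (L X).symm_apply_apply w⟩, h.smul fun X d => ?_⟩
  change (e X).equiv (e' X) (Equiv.refl _) (e X d) = _
  simp

/-- The element of `𝒢` which together with `t` stabilizes a point given by a butterfly diagram. -/
theorem RepresentsIn.smul_eq {m : Rep D} {e : ∀ X, Module.Basis (τ.dots X) ℂ (W D X)}
    (h : τ.RepresentsIn e m) {γ : Grp D}
    (hγ : ∀ X d, gl γ X (e X d) = monoK d.1.1 d.1.2 γ.2 • e X d) : γ • m = m := by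
  have hu := tu_ne_zero γ.2
  have hh := th_ne_zero γ.2
  have hc : ∀ U s, monoK U s γ.2 ≠ 0 := fun U s => mul_ne_zero (hu U) (zpow_ne_zero _ hh)
  have hi : ∀ X d, gi γ X (e X d) = (monoK d.1.1 d.1.2 γ.2)⁻¹ • e X d := fun X d => by
    rw [eq_inv_smul_iff₀ (hc _ _), ← map_smul, ← hγ, gi_gl]
  have hv : ∀ X U s, gl γ X (τ.dotVec e X U s) = monoK U s γ.2 • τ.dotVec e X U s :=
    fun X U s => map_dotVec (c := fun d => monoK d.1 d.2 γ.2) (hγ X) U s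
  -- The scaling of `B`, `B'` and `C` by `𝐡` cancels the drop in height by one.
  have hs : ∀ U s, th γ.2 * ((monoK U s γ.2)⁻¹ * monoK U (s - 1) γ.2) = 1 := fun U s => by
    have := hu U
    rw [monoK, monoK, zpow_sub_one₀ hh]
    field_simp
  apply Rep.ext <;> intro i
  · refine clm_ext_basis (e _) fun d => ?_
    simp [Rep.smul_def, Rep.act_A, hi, h.A, hv, smul_smul, hc]
  · refine clm_ext_basis (e _) fun d => ?_
    simp only [Rep.smul_def, Rep.act_b, hi, h.b, smul_apply,
      ContinuousLinearMap.comp_apply, map_smul]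
    split_ifs with hd
    -- The only dot seen by `b` has weight `𝐮_i 𝐡`, the factor by which the torus scales `b`.
    · have := hu i
      rw [hd]
      simp [monoK]
      field_simp
    · simp
  · refine ContinuousLinearMap.ext_ring ?_
    simp [Rep.smul_def, Rep.act_a, h.a, hv, smul_smul, monoK, hu]
  · refine clm_ext_basis (e _) fun d => ?_
    simp [Rep.smul_def, Rep.act_B, hi, h.B, hv, smul_smul, hs]
  · refine clm_ext_basis (e _) fun d => ?_
    simp [Rep.smul_def, Rep.act_B', hi, h.B', hv, smul_smul, hs]
  · refine clm_ext_basis (e _) fun d => ?_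
    simp [Rep.smul_def, Rep.act_C, hi, h.C, hv, smul_smul, hs]
  · refine clm_ext_basis (e _) fun d => ?_
    simp [Rep.smul_def, Rep.act_Dmap, hi, h.Dmap, hv, smul_smul, hc]

/-- The infinitesimal stabilizer of a point given by a butterfly diagram. -/
theorem RepresentsIn.annihilates {m : Rep D} {e : ∀ X, Module.Basis (τ.dots X) ℂ (W D X)}
    (h : τ.RepresentsIn e m) {y : ∀ X : D.D3, W D X →L[ℂ] W D X} {x : LieT D}
    (hy : ∀ X d, y X (e X d) = monoH d.1.1 d.1.2 x • e X d) : Annihilates y x m := by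
  have hv : ∀ X U s, y X (τ.dotVec e X U s) = monoH U s x • τ.dotVec e X U s :=
    fun X U s => map_dotVec (c := fun d => monoH d.1 d.2 x) (hy X) U s
  have hs : ∀ (U : D.D5) (s : ℤ), monoH U s x = monoH U (s - 1) x + x.2 := fun U s => by
    simp [monoH]; ring
  exact
  { A := fun U w => DFunLike.congr_fun (clm_ext_basis (e _)
      (f := y _ ∘L m.A U) (g := m.A U ∘L y _) fun d => by simp [hy, h.A, hv]) w
    b := fun U w => DFunLike.congr_fun (clm_ext_basis (e _)
      (f := m.b U ∘L y _) (g := ((x.2 : ℂ) + x.1 U) • m.b U) fun d => by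
        simp only [hy, h.b, smul_apply, ContinuousLinearMap.comp_apply,
          map_smul]
        split_ifs with hd
        · rw [hd]; simp [monoH]; ring
        · simp) w
    a := fun U => by simp [h.a, hv, monoH]
    B := fun U w => DFunLike.congr_fun (clm_ext_basis (e _)
      (f := m.B U ∘L y _) (g := y _ ∘L m.B U + (x.2 : ℂ) • m.B U) fun d => by
        simp [hy, h.B, hv, hs _ d.1.2, add_smul]) w
    B' := fun U w => DFunLike.congr_fun (clm_ext_basis (e _)
      (f := m.B' U ∘L y _) (g := y _ ∘L m.B' U + (x.2 : ℂ) • m.B' U) fun d => by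
        simp [hy, h.B', hv, hs _ d.1.2, add_smul]) w
    C := fun U w => DFunLike.congr_fun (clm_ext_basis (e _)
      (f := m.C U ∘L y _) (g := y _ ∘L m.C U + (x.2 : ℂ) • m.C U) fun d => by
        simp [hy, h.C, hv, hs _ d.1.2, add_smul]) w
    Dmap := fun U w => DFunLike.congr_fun (clm_ext_basis (e _)
      (f := y _ ∘L m.Dmap U) (g := m.Dmap U ∘L y _) fun d => by simp [hy, h.Dmap, hv]) w }

end TieDiagram

/-! ### Stabilizers along the orbit of a fixed point, and adapted points. -/

namespace TieDiagram

variable {D : BraneDiagram} {τ : TieDiagram D}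

/-- All points in the orbit `f` are given by the butterfly diagram of `f`. -/
theorem IsButterflyOf.exists_representsIn {f : Ch D} (h : τ.IsButterflyOf f) {q : Stable D}
    (hq : Ch.mk q = f) : ∃ e, τ.RepresentsIn e q.1 := by
  obtain ⟨p, hp, hr⟩ := h
  obtain ⟨e, he⟩ := hr.exists_representsIn
  obtain ⟨g, rfl⟩ : ∃ g : Gauge D, ofGauge g • p = q := Quotient.exact (hp.trans hq.symm)
  -- The new bases are the images of the old ones under `g`.
  let L : ∀ X, W D X ≃ₗ[ℂ] W D X := fun X => LinearEquiv.ofLinearMap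
    (gl (ofGauge g) X : W D X →ₗ[ℂ] W D X) (gi (ofGauge g) X : W D X →ₗ[ℂ] W D X)
    (LinearMap.ext fun w => gl_gi _ _ _) (LinearMap.ext fun w => gi_gl _ _ _)
  exact ⟨fun X => (e X).map (L X), he.smul fun X d => rfl⟩

/-- The stabilizer of a point given by a butterfly diagram. -/
theorem RepresentsIn.exists_fix {m : Rep D} {e : ∀ X, Module.Basis (τ.dots X) ℂ (W D X)}
    (h : τ.RepresentsIn e m) (t : Torus D) :
    ∃ g : Gauge D, (g, t) • m = m ∧
      ∀ X d, gl (g, t) X (e X d) = monoK d.1.1 d.1.2 t • e X d := by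
  have hc : ∀ (U : D.D5) s, monoK U s t ≠ 0 := fun U s =>
    mul_ne_zero (tu_ne_zero t U) (zpow_ne_zero _ (th_ne_zero t))
  let g : Gauge D := fun X => ⟨diagOp (e X) fun d => monoK d.1.1 d.1.2 t,
    diagOp (e X) fun d => (monoK d.1.1 d.1.2 t)⁻¹,
    clm_ext_basis (e X) fun d => by simp [diagOp_apply, hc],
    clm_ext_basis (e X) fun d => by simp [diagOp_apply, hc]⟩
  have hg : ∀ X d, gl (g, t) X (e X d) = monoK d.1.1 d.1.2 t • e X d := fun X d =>
    diagOp_apply _ _ _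
  exact ⟨g, h.smul_eq hg, hg⟩

/-- By freeness the gauge element compensating `t` is unique, so any choice of it, such as the one
in `fiberCharacter`, is the diagonal one. -/
theorem RepresentsIn.gl_of_fix {m : Rep D} (hm : m.IsStable)
    {e : ∀ X, Module.Basis (τ.dots X) ℂ (W D X)} (h : τ.RepresentsIn e m) {t : Torus D}
    {g : Gauge D} (hg : (g, t) • m = m) (X : D.D3) (d : τ.dots X) :
    gl (g, t) X (e X d) = monoK d.1.1 d.1.2 t • e X d := by
  obtain ⟨g', hg', he⟩ := h.exists_fix t
  -- The torus components of two compensating pairs for the same `t` cancel, which leaves a pure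
  -- gauge element fixing `m`.
  have hk : ofGauge (g'⁻¹ * g) • m = m := by
    have : ofGauge (g'⁻¹ * g) = (g', t)⁻¹ * (g, t) := by simp [ofGauge]
    rw [this, mul_smul, hg, inv_smul_eq_iff, hg']
  have := hm.eq_one hk
  rw [inv_mul_eq_one] at this
  rw [← this]
  exact he X d

/-- The orbit of a point given by a butterfly diagram contains an adapted point. -/
theorem IsButterflyOf.exists_isAdapted {f : Ch D} (h : τ.IsButterflyOf f) :
    ∃ p : Stable D, Ch.mk p = f ∧ IsAdapted p := by
  obtain ⟨p, hp, hr⟩ := h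
  obtain ⟨e, he⟩ := hr.exists_representsIn
  have hcard : ∀ X, Fintype.card (Fin (D.mult X)) = Fintype.card (τ.dots X) := fun X => by
    rw [← Module.finrank_eq_card_basis (e X), Fintype.card_fin, finrank_euclideanSpace_fin]
  let φ := fun X => Fintype.equivOfCardEq (hcard X)
  -- The standard orthonormal basis, labelled by the dots: an operator diagonal in it with real
  -- eigenvalues is Hermitian, as the compact Lie algebra requires.
  let e' := fun X => (EuclideanSpace.basisFun (Fin (D.mult X)) ℂ).toBasis.reindex (φ X)
  obtain ⟨g, hg⟩ := he.exists_gauge e'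
  refine ⟨ofGauge g • p, ?_, fun x => ?_⟩
  · rw [← hp]
    exact (Quotient.sound (s := gaugeSetoid D) ⟨g, rfl⟩).symm
  · let y : ∀ X : D.D3, Herm D X := fun X =>
      ⟨Matrix.toEuclideanCLM (𝕜 := ℂ) (Matrix.diagonal fun i =>
        monoH ((φ X) i).1.1 ((φ X) i).1.2 x), by
        refine IsSelfAdjoint.map (f := Matrix.toEuclideanCLM (n := Fin (D.mult X)) (𝕜 := ℂ)) ?_
        rw [IsSelfAdjoint, Matrix.star_eq_conjTranspose, Matrix.diagonal_conjTranspose]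
        congr 1
        funext i
        simp [monoH]⟩
    refine ⟨y, (infAct_eq_zero_iff _ _).2 (hg.annihilates fun X d => ?_)⟩
    change Matrix.toEuclideanCLM (𝕜 := ℂ) (Matrix.diagonal fun i =>
        monoH ((φ X) i).1.1 ((φ X) i).1.2 x) (e' X d) = _
    ext j
    simp [e', Matrix.mulVec_diagonal, Pi.single_apply]
    split_ifs with hj
    · simp [hj]
    · rfl

/-- Passes from subsets of the index type of the bases to the multiset of values on the dots. -/
theorem sum_powersetCard_dots {R : Type} [CommSemiring R] (X : D.D3)
    (c : (Σ _ : D.D5, ℤ) → R) (k : ℕ) :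
    ∑ s ∈ (Finset.univ : Finset (τ.dots X)).powersetCard k, ∏ d ∈ s, c d =
      ((τ.dots X).val.map c).esymm k := by
  have h : ((Finset.univ : Finset {d // d ∈ τ.dots X}).val.map fun d => c d.1) = (τ.dots X).val.map c := by
    rw [← Finset.attach_eq_univ, Finset.attach_val]
    exact Multiset.attach_map_val' _ c
  rw [← h, Finset.esymm_map_val]

end TieDiagram

theorem esymm_map_apply {α β R : Type} [CommSemiring R] (s : Finset α) (c : α → β → R) (k : ℕ)
    (b : β) : (s.val.map c).esymm k b = (s.val.map fun a => c a b).esymm k := by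
  simp [Finset.esymm_map_val]

end Bow

end

/-! ### The restriction formulas. -/

theorem mainTheorem2 (D : Bow.BraneDiagram) (f : Bow.Ch D)
    (hf : f ∈ MulAction.fixedPoints (Bow.Torus D) (Bow.Ch D))
    (τ : Bow.TieDiagram D) (hτ : τ.IsButterflyOf f) (X : D.D3) :
    Bow.locK f (Bow.kClass (Bow.taut D X)) = ∑ d ∈ τ.dots X, Bow.monoK d.1 d.2 ∧
    (∀ k : ℕ, Bow.locK f (Bow.kClass (Bow.tautExt D X k)) =
      ((τ.dots X).val.map fun d => Bow.monoK d.1 d.2).esymm k) ∧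
    (∀ k : ℕ, Bow.locH f (Bow.chern D X k) =
      ((τ.dots X).val.map fun d => Bow.monoH d.1 d.2).esymm k) := by
  obtain ⟨e, he⟩ := hτ.exists_representsIn (Quotient.out_eq f)
  have hloc : ∀ E : Bow.EqBundle D,
      Bow.locK f (Bow.kClass E) = Bow.fiberCharacter (Quotient.out f) E := fun E => by
    change Finsupp.lift (Bow.Torus D → ℂ) ℂ (Bow.EqBundle D)
      (Bow.fiberCharacter (Quotient.out f)) (Finsupp.single E 1) = _
    simp
  -- This rules out the default value `0` in `fiberCharacter` for every `t`.
  have hfix : ∀ t : Bow.Torus D, ∃ g : Bow.Gauge D,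
      (g, t) • (Quotient.out f : Bow.Stable D) = Quotient.out f := fun t => by
    obtain ⟨g, hg, -⟩ := he.exists_fix t
    exact ⟨g, Subtype.ext hg⟩
  refine ⟨?_, fun k => ?_, fun k => ?_⟩
  · rw [hloc]
    funext t
    rw [Bow.fiberCharacter, dif_pos (hfix t), Finset.sum_apply]
    have h := he.gl_of_fix (Quotient.out f).2 (congrArg Subtype.val (hfix t).choose_spec) X
    refine (Bow.trace_of_eigenbasis (e X) _ _ h).trans ?_
    exact Finset.sum_coe_sort (τ.dots X) fun d => Bow.monoK d.1 d.2 t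
  · rw [hloc]
    funext t
    rw [Bow.fiberCharacter, dif_pos (hfix t), Bow.esymm_map_apply, ← τ.sum_powersetCard_dots]
    have h := he.gl_of_fix (Quotient.out f).2 (congrArg Subtype.val (hfix t).choose_spec) X
    exact Bow.elemInv_of_eigenbasis (e X) _ _ h k
  · funext x
    -- The cohomological restriction is computed at another representative of `f`, which is adapted
    -- because an adapted one exists; it gets its own bases `e'` below.
    have had := hτ.exists_isAdapted
    have hp : Bow.Ch.mk (Bow.adaptedPoint f) = f ∧ Bow.IsAdapted (Bow.adaptedPoint f) := by
      rw [Bow.adaptedPoint, dif_pos had]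
      exact had.choose_spec
    change Bow.evalStabilizer (Bow.adaptedPoint f) (Bow.chernForm D X k) x = _
    rw [Bow.evalStabilizer, dif_pos (hp.2 x), Bow.esymm_map_apply, ← τ.sum_powersetCard_dots]
    obtain ⟨e', he'⟩ := hτ.exists_representsIn hp.1
    -- The operators chosen by `evalStabilizer` are known only through the equations they satisfy;
    -- uniqueness identifies them with the diagonal ones.
    have h1 := (Bow.infAct_eq_zero_iff _ _).1 (hp.2 x).choose_spec
    have h2 := he'.annihilates (x := x)
      (y := fun X => Bow.diagOp (e' X) fun d => Bow.monoH d.1.1 d.1.2 x)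
      fun X d => Bow.diagOp_apply _ _ _
    have h3 := congrFun (h1.eq (Bow.adaptedPoint f).2 h2) X
    refine Bow.elemInv_of_eigenbasis (e' X) _ _ (fun d => ?_) k
    exact (DFunLike.congr_fun h3 (e' X d)).trans (Bow.diagOp_apply _ _ _)
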